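/- Let $k$ be a field and let $(S,L)$ be a Lie--Rinehart algebra over $k$: $S$ is a commutative $k$-algebra, $L$ is a $k$-Lie algebra with a compatible $S$-module structure and a morphism of Lie algebras $L\to\mathrm{Der}_k(S)$, $\alpha\mapsto\alpha_S$, such that $(s\alpha)_S(t)=s\,\alpha_S(t)$ and $[\alpha,s\beta]=s[\alpha,\beta]+\alpha_S(s)\beta$ for all $s,t\in S$ and $\alpha,\beta\in L$. Assume that $L$ is a projective $S$-module. Let $U=U(S,L)$ be the universal enveloping algebra, with its canonical algebra morphism $i:S\to U$ and Lie algebra morphism $j:L\to U$ (written below as inclusions, so $i(s)j(\alpha)=j(s\alpha)$ and $j(\alpha)i(s)-i(s)j(\alpha)=i(\alpha_S(s))$). Write $S^e=S\otimes_k S$ and $U^e=U\otimes_k U^{\mathrm{op}}$, let $M$ be a $U^e$-module, and let $H^n(S,M)=\mathrm{Ext}^n_{S^e}(S,M)$. (Injective side.) For a $U^e$-module $N$, $\mathrm{Hom}_{S^e}(S,N)$ is a $U$-module by $$(t\cdot\varphi)(s)=(t\otimes1)\varphi(s),\qquad (\alpha\cdot\varphi)(s)=(\alpha\otimes1)\varphi(s)-(1\otimes\alpha)\varphi(s)-\varphi(\alpha_S(s)),$$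 for $s,t\in S$, $\alpha\in L$, functorially in $N$. Let $M\to I^\bullet$ be a $U^e$-injective resolution. (Projective side.) Let $\varepsilon:P_\bullet\to S$ be an $S^e$-projective resolution, where $(s_1\otimes s_2)\cdot t=s_1ts_2$ on $S$. For $\alpha\in L$ put $\alpha_S^e=\alpha_S\otimes1+1\otimes\alpha_S$. An $\alpha_S^e$-lifting of $\alpha_S$ is a family of $k$-linear maps $\alpha_q:P_q\to P_q$, $q\ge0$, commuting with the differentials, with $\varepsilon\alpha_0=\alpha_S\varepsilon$ and $\alpha_q(a\,p)=\alpha_S^e(a)\,p+a\,\alpha_q(p)$ for $a\in S^e$, $p\in P_q$; it defines on $\mathrm{Hom}_{S^e}(P_q,M)$ the map $\alpha_q^\sharp(\phi)=(\alpha\otimes1-1\otimes\alpha)\circ\phi-\phi\circ\alpha_q$, which sends cocycles to cocycles. Let $S$ act on $\mathrm{Hom}_{S^e}(P_q,M)$ by $(s\cdot\phi)(p)=(s\otimes1)\phi(p)$. Then every $\alpha\in L$ has an $\alpha_S^e$-lifting to $P_\bullet$, every $I^q$ is injective as an $S^e$-module (so that cocycles of $\mathrm{Hom}_{S^e}(S,I^\bullet)$,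 like those of $\mathrm{Hom}_{S^e}(P_\bullet,M)$, have classes in $H^\bullet(S,M)$), and for every $n\ge0$: 1. there is a unique $U$-module structure on the $k$-vector space $H^n(S,M)$ with $u\cdot[\psi]=[u\cdot\psi]$ for all $u\in U$ and all $n$-cocycles $\psi$ of $\mathrm{Hom}_{S^e}(S,I^\bullet)$; 2. there is a unique $S$-module structure on $H^n(S,M)$ with $s\cdot[\phi]=[s\cdot\phi]$, and a unique $L$-Lie module structure $\alpha\mapsto\nabla_\alpha^n$ on $H^n(S,M)$ with $\nabla^n_\alpha[\phi]=[\alpha^\sharp_n(\phi)]$, for all $s\in S$, $\alpha\in L$, all $n$-cocycles $\phi$ of $\mathrm{Hom}_{S^e}(P_\bullet,M)$ and all $\alpha_S^e$-liftings of $\alpha_S$ to $P_\bullet$; 3. the $S$- and $L$-module structures in 2 are equal to those obtained by restricting the $U$-module structure in 1 along $i$ and $j$. -/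

import Mathlib

open CategoryTheory TensorProduct

open scoped ModuleCat

attribute [local instance 100] LieRing.ofAssociativeRing

universe u

noncomputable section

namespace LieRinehart

/-! ### The universal enveloping algebra of a Lie–Rinehart algebra -/

section Enveloping

variable (k S L : Type u) [Field k] [CommRing S] [Algebra k S] [LieRing L] [LieAlgebra k L]
  [Module S L] [LieRingModule L S] [LieRinehartRing S L] [LieRinehartAlgebra k S L]

/-- The defining relations of the enveloping algebra, on the tensor algebra of `S × L`:
`s ↦ (s, 0)` becomes a morphism of algebras `i`, `α ↦ (0, α)` a morphism of Lie algebras `j`,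
and `i(s) j(α) = j(s α)`, `j(α) i(s) - i(s) j(α) = i(α_S(s))`. -/
inductive EnvRel : TensorAlgebra k (S × L) → TensorAlgebra k (S × L) → Prop
  | one : EnvRel (TensorAlgebra.ι k ((1 : S), (0 : L))) 1
  | mul (s t : S) : EnvRel
      (TensorAlgebra.ι k (s * t, (0 : L)))
      (TensorAlgebra.ι k (s, (0 : L)) * TensorAlgebra.ι k (t, (0 : L)))
  | lie (α β : L) : EnvRel
      (TensorAlgebra.ι k ((0 : S), ⁅α, β⁆))
      (TensorAlgebra.ι k ((0 : S), α) * TensorAlgebra.ι k ((0 : S), β)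
        - TensorAlgebra.ι k ((0 : S), β) * TensorAlgebra.ι k ((0 : S), α))
  | smul (s : S) (α : L) : EnvRel
      (TensorAlgebra.ι k (s, (0 : L)) * TensorAlgebra.ι k ((0 : S), α))
      (TensorAlgebra.ι k ((0 : S), s • α))
  | anchor (α : L) (s : S) : EnvRel
      (TensorAlgebra.ι k ((0 : S), α) * TensorAlgebra.ι k (s, (0 : L))
        - TensorAlgebra.ι k (s, (0 : L)) * TensorAlgebra.ι k ((0 : S), α))
      (TensorAlgebra.ι k (⁅α, s⁆, (0 : L)))

/-- The universal enveloping algebra `U = U(S, L)`. -/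
def Env : Type u := RingQuot (EnvRel k S L)

instance : Ring (Env k S L) := inferInstanceAs (Ring (RingQuot (EnvRel k S L)))

instance : Algebra k (Env k S L) := inferInstanceAs (Algebra k (RingQuot (EnvRel k S L)))

/-- The quotient map from the tensor algebra. -/
def Env.mk : TensorAlgebra k (S × L) →ₐ[k] Env k S L := RingQuot.mkAlgHom k (EnvRel k S L)

variable {k S L} in
theorem Env.mk_rel {x y : TensorAlgebra k (S × L)} (h : EnvRel k S L x y) :
    Env.mk k S L x = Env.mk k S L y :=
  RingQuot.mkAlgHom_rel k h

/-- The morphism of algebras `i : S → U`. -/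
def Env.i : S →ₐ[k] Env k S L :=
  AlgHom.ofLinearMap
    ((Env.mk k S L).toLinearMap ∘ₗ TensorAlgebra.ι k ∘ₗ LinearMap.inl k S L)
    (by simpa using Env.mk_rel (EnvRel.one (k := k) (S := S) (L := L)))
    (fun s t => by simpa using Env.mk_rel (EnvRel.mul (k := k) (L := L) s t))

/-- The morphism of Lie algebras `j : L → U`. -/
def Env.j : L →ₗ⁅k⁆ Env k S L :=
  { (Env.mk k S L).toLinearMap ∘ₗ TensorAlgebra.ι k ∘ₗ LinearMap.inr k S L with
    map_lie' := fun {α β} => by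
      simpa [LieRing.of_associative_ring_bracket] using
        Env.mk_rel (EnvRel.lie (k := k) (S := S) α β) }

theorem Env.i_mul_j (s : S) (α : L) :
    Env.i k S L s * Env.j k S L α = Env.j k S L (s • α) := by
  have h := Env.mk_rel (EnvRel.smul (k := k) s α)
  rw [map_mul] at h
  exact h

theorem Env.j_mul_i (α : L) (s : S) :
    Env.j k S L α * Env.i k S L s = Env.i k S L s * Env.j k S L α + Env.i k S L ⁅α, s⁆ := by
  have h := Env.mk_rel (EnvRel.anchor (k := k) α s)
  rw [map_sub, map_mul, map_mul, sub_eq_iff_eq_add'] at h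
  exact h

variable {k S L} in
/-- The universal property of `U`. -/
def Env.lift {B : Type u} [Ring B] [Algebra k B] (f : S →ₐ[k] B) (g : L →ₗ⁅k⁆ B)
    (hsmul : ∀ s α, f s * g α = g (s • α))
    (hanchor : ∀ α s, g α * f s - f s * g α = f ⁅α, s⁆) : Env k S L →ₐ[k] B :=
  RingQuot.liftAlgHom k ⟨TensorAlgebra.lift k (f.toLinearMap.coprod (g : L →ₗ[k] B)), by
    intro x y h
    cases h with
    | one => simp
    | mul s t => simp
    | lie α β => simp [LieRing.of_associative_ring_bracket]
    | smul s α => simp [hsmul]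
    | anchor α s => simp [hanchor]⟩

variable {k S L} in
theorem Env.lift_i {B : Type u} [Ring B] [Algebra k B] (f : S →ₐ[k] B) (g : L →ₗ⁅k⁆ B)
    (hsmul : ∀ s α, f s * g α = g (s • α))
    (hanchor : ∀ α s, g α * f s - f s * g α = f ⁅α, s⁆) (s : S) :
    Env.lift f g hsmul hanchor (Env.i k S L s) = f s := by
  change RingQuot.liftAlgHom k _ (RingQuot.mkAlgHom k _ (TensorAlgebra.ι k (s, (0 : L)))) = _
  simp

variable {k S L} in
theorem Env.lift_j {B : Type u} [Ring B] [Algebra k B] (f : S →ₐ[k] B) (g : L →ₗ⁅k⁆ B)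
    (hsmul : ∀ s α, f s * g α = g (s • α))
    (hanchor : ∀ α s, g α * f s - f s * g α = f ⁅α, s⁆) (α : L) :
    Env.lift f g hsmul hanchor (Env.j k S L α) = g α := by
  change RingQuot.liftAlgHom k _ (RingQuot.mkAlgHom k _ (TensorAlgebra.ι k ((0 : S), α))) = _
  simp

variable {k S L} in
theorem Env.induction {C : Env k S L → Prop} (hi : ∀ s, C (Env.i k S L s))
    (hj : ∀ α, C (Env.j k S L α)) (hadd : ∀ u v, C u → C v → C (u + v))
    (hmul : ∀ u v, C u → C v → C (u * v)) (u : Env k S L) : C u := by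
  obtain ⟨x, rfl⟩ := RingQuot.mkAlgHom_surjective k (EnvRel k S L) u
  change C (Env.mk k S L x)
  induction x using TensorAlgebra.induction with
  | algebraMap r =>
    have h := hi (algebraMap k S r)
    rwa [AlgHom.commutes, ← AlgHom.commutes (Env.mk k S L)] at h
  | ι x =>
    have h := hadd _ _ (hi x.1) (hj x.2)
    have e : Env.i k S L x.1 + Env.j k S L x.2 = Env.mk k S L (TensorAlgebra.ι k x) := by
      change Env.mk k S L (TensorAlgebra.ι k (x.1, (0 : L)))
        + Env.mk k S L (TensorAlgebra.ι k ((0 : S), x.2)) = _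
      rw [← map_add, ← map_add]
      simp
    rwa [e] at h
  | mul a b ha hb => rw [map_mul]; exact hmul _ _ ha hb
  | add a b ha hb => rw [map_add]; exact hadd _ _ ha hb

end Enveloping

/-! ### Enveloping algebras `S^e`, `U^e` and the bimodules over them -/

section Bimodules

variable (k S L : Type u) [Field k] [CommRing S] [Algebra k S] [LieRing L] [LieAlgebra k L]
  [Module S L] [LieRingModule L S] [LieRinehartRing S L] [LieRinehartAlgebra k S L]

/-- `S^e`; the algebra `S` being commutative, it is its own opposite. -/
abbrev Se : Type u := S ⊗[k] S

/-- `U^e`. -/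
abbrev Ue : Type u := Env k S L ⊗[k] (Env k S L)ᵐᵒᵖ

/-- The morphism of algebras `S^e → U^e`, `s ⊗ t ↦ i(s) ⊗ i(t)`. -/
def seToUe : Se k S →ₐ[k] Ue k S L :=
  Algebra.TensorProduct.map (Env.i k S L)
    ((Env.i k S L).toOpposite fun s t => (Commute.all s t).map (Env.i k S L))

/-- Restriction of scalars from `U^e`-modules to `S^e`-modules. -/
abbrev res : ModuleCat.{u} (Ue k S L) ⥤ ModuleCat.{u} (Se k S) :=
  ModuleCat.restrictScalars (seToUe k S L).toRingHom

/-- `S` as an `S^e`-module, `(s₁ ⊗ s₂) · t = s₁ t s₂`. -/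
abbrev bimod : ModuleCat.{u} (Se k S) :=
  (ModuleCat.restrictScalars (Algebra.TensorProduct.lmul' k (S := S)).toRingHom).obj
    (ModuleCat.of S S)

variable {k S L}

/-- The Hochschild cohomology `H^n(S, M) = Ext^n_{S^e}(S, M)` of `S` with values in a
`U^e`-module `M`. -/
abbrev HH (M : ModuleCat.{u} (Ue k S L)) (n : ℕ) : Type u :=
  Abelian.Ext (bimod k S) ((res k S L).obj M) n

end Bimodules

/-! ### Operators over a derivation and their liftings -/

section Delta

variable {k : Type u} [Field k] {A : Type u} [CommRing A] [Algebra k A]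

/-- `f` is a `δ`-operator: `f(av) = δ(a) v + a f(v)`. Since `δ` vanishes on `k`, an additive map
with this property is automatically `k`-linear. -/
def IsDeltaOperator (δ : Derivation k A A) {V : Type u} [AddCommGroup V] [Module A V]
    (f : V →+ V) : Prop :=
  ∀ (a : A) (v : V), f (a • v) = δ a • v + a • f v

/-- For `δ`-operators `f` on `V` and `g` on `W`, the endomorphism `φ ↦ g ∘ φ - φ ∘ f` of
`Hom_A(V, W)`. -/
def sharp {δ : Derivation k A A} {V W : Type u} [AddCommGroup V] [Module A V]
    [AddCommGroup W] [Module A W] {f : V →+ V} {g : W →+ W} (hf : IsDeltaOperator δ f)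
    (hg : IsDeltaOperator δ g) (φ : V →ₗ[A] W) : V →ₗ[A] W where
  toFun v := g (φ v) - φ (f v)
  map_add' v w := by simp only [map_add]; abel
  map_smul' a v := by
    simp only [map_smul, RingHom.id_apply, hg a, hf a, map_add, smul_sub]
    abel

theorem sharp_apply {δ : Derivation k A A} {V W : Type u} [AddCommGroup V] [Module A V]
    [AddCommGroup W] [Module A W] {f : V →+ V} {g : W →+ W} (hf : IsDeltaOperator δ f)
    (hg : IsDeltaOperator δ g) (φ : V →ₗ[A] W) (v : V) :
    sharp hf hg φ v = g (φ v) - φ (f v) :=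
  rfl

/-- A `δ`-lifting of an operator `f : V → V` to a projective resolution of `V`. -/
structure DeltaLifting (δ : Derivation k A A) {V : ModuleCat.{u} A} (f : V →+ V)
    (P : ProjectiveResolution V) where
  /-- the components of the lifting -/
  op : ∀ q : ℕ, P.complex.X q →+ P.complex.X q
  isDeltaOperator : ∀ q, IsDeltaOperator δ (op q)
  comm : ∀ (q : ℕ) (x : P.complex.X (q + 1)),
    (P.complex.d (q + 1) q).hom (op (q + 1) x) = op q ((P.complex.d (q + 1) q).hom x)
  comm_augmentation : ∀ x : P.complex.X 0,
    (show P.complex.X 0 ⟶ V from P.π.f 0).hom (op 0 x) =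
      f ((show P.complex.X 0 ⟶ V from P.π.f 0).hom x)

end Delta

section Actions

variable {k S L : Type u} [Field k] [CommRing S] [Algebra k S] [LieRing L] [LieAlgebra k L]
  [Module S L] [LieRingModule L S] [LieRinehartRing S L] [LieRinehartAlgebra k S L]

variable (k S) in
/-- The derivation `α_S^e = α_S ⊗ 1 + 1 ⊗ α_S` of `S^e`. -/
def anchorE (α : L) : Derivation k (Se k S) (Se k S) :=
  Derivation.mk'
    ((LieRinehartAlgebra.anchor k S L α : S →ₗ[k] S).rTensor S
      + (LieRinehartAlgebra.anchor k S L α : S →ₗ[k] S).lTensor S)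
    (by
      intro a b
      induction a using TensorProduct.induction_on with
      | zero => simp
      | add a a' h h' => simp only [add_mul, map_add, h, h', add_smul, smul_add]; abel
      | tmul s t =>
        induction b using TensorProduct.induction_on with
        | zero => simp
        | add b b' h h' => simp only [mul_add, map_add, h, h', add_smul, smul_add]; abel
        | tmul s' t' =>
          simp [add_tmul, tmul_add, mul_add, mul_comm]
          abel)

variable (k) in
/-- `α_S` as an additive endomorphism of the `S^e`-module `S`. -/
def anchorOp (α : L) : bimod k S →+ bimod k S :=
  ((LieRinehartAlgebra.anchor k S L α : S →ₗ[k] S) : S →+ S)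

theorem anchorOp_isDeltaOperator (α : L) :
    IsDeltaOperator (anchorE k S α) (anchorOp k (S := S) α) := by
  intro a (v : S)
  change (⁅α, (Algebra.TensorProduct.lmul' k (S := S) a * v : S)⁆ : S) =
    Algebra.TensorProduct.lmul' k (S := S) (anchorE k S α a) * v
      + Algebra.TensorProduct.lmul' k (S := S) a * ⁅α, v⁆
  induction a using TensorProduct.induction_on with
  | zero => simp
  | add a a' h h' => simp only [map_add, add_mul, lie_add, h, h']; ring
  | tmul s t =>
    simp [anchorE]
    ring

/-- `α_M(m) = (α ⊗ 1) m - (1 ⊗ α) m`. -/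
def commOp (M : ModuleCat.{u} (Ue k S L)) (α : L) : (res k S L).obj M →+ (res k S L).obj M :=
  (DistribSMul.toAddMonoidHom M (Env.j k S L α ⊗ₜ[k] (1 : (Env k S L)ᵐᵒᵖ) : Ue k S L)
    - DistribSMul.toAddMonoidHom M
        ((1 : Env k S L) ⊗ₜ[k] MulOpposite.op (Env.j k S L α) : Ue k S L) : M →+ M)

theorem commOp_isDeltaOperator (M : ModuleCat.{u} (Ue k S L)) (α : L) :
    IsDeltaOperator (anchorE k S α) (commOp M α) := by
  intro a (v : M)
  have key : (Env.j k S L α ⊗ₜ[k] (1 : (Env k S L)ᵐᵒᵖ)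
        - (1 : Env k S L) ⊗ₜ[k] MulOpposite.op (Env.j k S L α)) * seToUe k S L a
      = seToUe k S L (anchorE k S α a) + seToUe k S L a *
        (Env.j k S L α ⊗ₜ[k] (1 : (Env k S L)ᵐᵒᵖ)
          - (1 : Env k S L) ⊗ₜ[k] MulOpposite.op (Env.j k S L α)) := by
    induction a using TensorProduct.induction_on with
    | zero => simp
    | add a a' h h' =>
      simp only [map_add, mul_add, add_mul, h, h']
      abel
    | tmul s t =>
      simp [anchorE, seToUe, mul_sub, sub_mul, Env.j_mul_i, add_tmul, ← MulOpposite.op_mul,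
        tmul_add]
      abel
  have key' := congrArg (fun x : Ue k S L => x • v) key
  simp only [add_smul, sub_smul, mul_smul] at key'
  exact key'

/-- `Hom_{S^e}(S, M)`. -/
abbrev GHom (M : ModuleCat.{u} (Ue k S L)) : Type u :=
  bimod k S →ₗ[Se k S] (res k S L).obj M

variable (k S) in
/-- The left `S`-action `(s · φ)(v) = (s ⊗ 1) φ(v)` on `Hom_{S^e}(V, W)`. -/
def homS (V W : ModuleCat.{u} (Se k S)) : S →ₐ[k] Module.End k (V →ₗ[Se k S] W) :=
  (Algebra.lsmul k k (V →ₗ[Se k S] W) : Se k S →ₐ[k] Module.End k (V →ₗ[Se k S] W)).comp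
    Algebra.TensorProduct.includeLeft

theorem homS_apply (V W : ModuleCat.{u} (Se k S)) (s : S) (φ : V →ₗ[Se k S] W) (v : V) :
    homS k S V W s φ v = (s ⊗ₜ[k] (1 : S) : Se k S) • φ v :=
  rfl

theorem commOp_apply (M : ModuleCat.{u} (Ue k S L)) (α : L) (m : M) :
    commOp M α m = ((Env.j k S L α ⊗ₜ[k] (1 : (Env k S L)ᵐᵒᵖ) : Ue k S L) • m
      - ((1 : Env k S L) ⊗ₜ[k] MulOpposite.op (Env.j k S L α) : Ue k S L) • m : M) :=
  rfl

theorem anchorOp_apply (α : L) (s : S) : anchorOp k (S := S) α s = (⁅α, s⁆ : S) :=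
  rfl

theorem res_smul (M : ModuleCat.{u} (Ue k S L)) (a : Se k S) (m : M) :
    (a • (show (res k S L).obj M from m) : (res k S L).obj M) = seToUe k S L a • m :=
  rfl

theorem GHom.symm_apply {M : ModuleCat.{u} (Ue k S L)} (φ : GHom M) (s : S) (t : bimod k S) :
    ((1 : S) ⊗ₜ[k] s : Se k S) • φ t = (s ⊗ₜ[k] (1 : S) : Se k S) • φ t := by
  rw [← map_smul, ← map_smul]
  congr 1
  change Algebra.TensorProduct.lmul' k (S := S) (1 ⊗ₜ[k] s) * (show S from t) =
    Algebra.TensorProduct.lmul' k (S := S) (s ⊗ₜ[k] 1) * (show S from t)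
  simp

theorem commOp_add (M : ModuleCat.{u} (Ue k S L)) (α β : L) (m : (res k S L).obj M) :
    commOp M (α + β) m = commOp M α m + commOp M β m := by
  have h (m : M) : ((Env.j k S L (α + β) ⊗ₜ[k] (1 : (Env k S L)ᵐᵒᵖ) : Ue k S L) • m
      - ((1 : Env k S L) ⊗ₜ[k] MulOpposite.op (Env.j k S L (α + β)) : Ue k S L) • m : M) =
      (Env.j k S L α ⊗ₜ[k] (1 : (Env k S L)ᵐᵒᵖ) : Ue k S L) • m
      - ((1 : Env k S L) ⊗ₜ[k] MulOpposite.op (Env.j k S L α) : Ue k S L) • m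
      + ((Env.j k S L β ⊗ₜ[k] (1 : (Env k S L)ᵐᵒᵖ) : Ue k S L) • m
      - ((1 : Env k S L) ⊗ₜ[k] MulOpposite.op (Env.j k S L β) : Ue k S L) • m) := by
    simp only [map_add, add_tmul, MulOpposite.op_add, tmul_add, add_smul]
    abel
  exact h m

theorem commOp_lie (M : ModuleCat.{u} (Ue k S L)) (α β : L) (m : (res k S L).obj M) :
    commOp M ⁅α, β⁆ m = commOp M α (commOp M β m) - commOp M β (commOp M α m) := by
  have h (m : M) : ((Env.j k S L ⁅α, β⁆ ⊗ₜ[k] (1 : (Env k S L)ᵐᵒᵖ) : Ue k S L) • m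
      - ((1 : Env k S L) ⊗ₜ[k] MulOpposite.op (Env.j k S L ⁅α, β⁆) : Ue k S L) • m : M) =
      (((Env.j k S L α ⊗ₜ[k] (1 : (Env k S L)ᵐᵒᵖ) : Ue k S L)
          - (1 : Env k S L) ⊗ₜ[k] MulOpposite.op (Env.j k S L α)) *
        ((Env.j k S L β ⊗ₜ[k] (1 : (Env k S L)ᵐᵒᵖ) : Ue k S L)
          - (1 : Env k S L) ⊗ₜ[k] MulOpposite.op (Env.j k S L β))) • m
      - (((Env.j k S L β ⊗ₜ[k] (1 : (Env k S L)ᵐᵒᵖ) : Ue k S L)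
          - (1 : Env k S L) ⊗ₜ[k] MulOpposite.op (Env.j k S L β)) *
        ((Env.j k S L α ⊗ₜ[k] (1 : (Env k S L)ᵐᵒᵖ) : Ue k S L)
          - (1 : Env k S L) ⊗ₜ[k] MulOpposite.op (Env.j k S L α))) • m := by
    rw [← sub_smul, ← sub_smul]
    congr 1
    simp only [LieHom.map_lie, LieRing.of_associative_ring_bracket, mul_sub, sub_mul,
      Algebra.TensorProduct.tmul_mul_tmul, one_mul, mul_one, sub_tmul, tmul_sub,
      MulOpposite.op_sub, MulOpposite.op_mul]
    abel
  have h' := fun m : M => h m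
  simp only [mul_smul, sub_smul] at h'
  exact h' m

/-- On the image of `φ : S → M`, where both actions of `S` agree, `(sα)_M = s α_M`. -/
theorem commOp_smul {M : ModuleCat.{u} (Ue k S L)} (s : S) (α : L) (m : (res k S L).obj M)
    (hm : ((1 : S) ⊗ₜ[k] s : Se k S) • m = (s ⊗ₜ[k] (1 : S) : Se k S) • m) :
    commOp M (s • α) m = (s ⊗ₜ[k] (1 : S) : Se k S) • commOp M α m := by
  have h (m : M) (hm : seToUe k S L ((1 : S) ⊗ₜ[k] s : Se k S) • m
        = seToUe k S L (s ⊗ₜ[k] (1 : S) : Se k S) • m) :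
      ((Env.j k S L (s • α) ⊗ₜ[k] (1 : (Env k S L)ᵐᵒᵖ) : Ue k S L) • m
      - ((1 : Env k S L) ⊗ₜ[k] MulOpposite.op (Env.j k S L (s • α)) : Ue k S L) • m : M) =
      seToUe k S L (s ⊗ₜ[k] (1 : S)) •
        ((Env.j k S L α ⊗ₜ[k] (1 : (Env k S L)ᵐᵒᵖ) : Ue k S L) • m
      - ((1 : Env k S L) ⊗ₜ[k] MulOpposite.op (Env.j k S L α) : Ue k S L) • m) := by
    have e1 : (Env.j k S L (s • α) ⊗ₜ[k] (1 : (Env k S L)ᵐᵒᵖ) : Ue k S L) =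
        seToUe k S L (s ⊗ₜ[k] (1 : S)) * (Env.j k S L α ⊗ₜ[k] (1 : (Env k S L)ᵐᵒᵖ)) := by
      simp [seToUe, Env.i_mul_j]
    have e2 : ((1 : Env k S L) ⊗ₜ[k] MulOpposite.op (Env.j k S L (s • α)) : Ue k S L) =
        ((1 : Env k S L) ⊗ₜ[k] MulOpposite.op (Env.j k S L α)) *
          seToUe k S L ((1 : S) ⊗ₜ[k] s) := by
      simp [seToUe, ← Env.i_mul_j]
    have e3 : ((1 : Env k S L) ⊗ₜ[k] MulOpposite.op (Env.j k S L α)) *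
          seToUe k S L (s ⊗ₜ[k] (1 : S)) = seToUe k S L (s ⊗ₜ[k] (1 : S)) *
          ((1 : Env k S L) ⊗ₜ[k] MulOpposite.op (Env.j k S L α)) := by
      simp [seToUe]
    rw [e1, e2, mul_smul, mul_smul, hm, smul_sub,
      ← mul_smul (_ : Ue k S L) (seToUe k S L (s ⊗ₜ[k] (1 : S))) m, e3, mul_smul]
  exact h m hm

/-- The action of `α ∈ L` on `Hom_{S^e}(S, M)`:
`(α · φ)(s) = (α ⊗ 1) φ(s) - (1 ⊗ α) φ(s) - φ(α_S(s))`. -/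
def gLieMap (M : ModuleCat.{u} (Ue k S L)) (α : L) : Module.End k (GHom M) where
  toFun := sharp (anchorOp_isDeltaOperator α) (commOp_isDeltaOperator M α)
  map_add' φ ψ := by
    ext v
    simp only [LinearMap.add_apply, sharp_apply, map_add]
    abel
  map_smul' c φ := by
    ext v
    have h := commOp_isDeltaOperator M α (algebraMap k (Se k S) c) (φ v)
    simp only [Derivation.map_algebraMap, zero_smul, zero_add, algebraMap_smul] at h
    simp only [LinearMap.smul_apply, sharp_apply, RingHom.id_apply, h, smul_sub]

theorem gLieMap_apply (M : ModuleCat.{u} (Ue k S L)) (α : L) (φ : GHom M) (v : bimod k S) :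
    gLieMap M α φ v = commOp M α (φ v) - φ (anchorOp k α v) :=
  rfl

theorem gLieMap_smul (M : ModuleCat.{u} (Ue k S L)) (s : S) (α : L) :
    homS k S (bimod k S) ((res k S L).obj M) s * gLieMap M α = gLieMap M (s • α) := by
  ext φ v
  have e : anchorOp k (s • α) v = (s ⊗ₜ[k] (1 : S) : Se k S) • anchorOp k α v := by
    have h (v : S) : (⁅s • α, v⁆ : S) =
        Algebra.TensorProduct.lmul' k (S := S) (s ⊗ₜ[k] 1) * ⁅α, v⁆ := by
      simp
    exact h v
  rw [gLieMap_apply, e, commOp_smul s α _ (GHom.symm_apply φ s v), map_smul, Module.End.mul_apply,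
    homS_apply, gLieMap_apply, smul_sub]

/-- The action of `L` on `Hom_{S^e}(S, M)`, as a morphism of Lie algebras. -/
def gLie (M : ModuleCat.{u} (Ue k S L)) : L →ₗ⁅k⁆ Module.End k (GHom M) where
  toFun := gLieMap M
  map_add' α β := by
    ext φ v
    have e : anchorOp k (α + β) v = anchorOp k α v + anchorOp k β v := by
      exact add_lie α β (show S from v)
    simp only [gLieMap_apply, commOp_add, e, map_add, LinearMap.add_apply]
    abel
  map_smul' c α := by
    rw [← algebraMap_smul S c α, ← gLieMap_smul, AlgHom.commutes]
    ext φ v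
    simp [Module.algebraMap_end_apply]
  map_lie' {α β} := by
    ext φ v
    have e : anchorOp k ⁅α, β⁆ v
        = anchorOp k α (anchorOp k β v) - anchorOp k β (anchorOp k α v) := by
      exact lie_lie α β (show S from v)
    simp only [LieRing.of_associative_ring_bracket, LinearMap.sub_apply, Module.End.mul_apply,
      gLieMap_apply, e, commOp_lie, map_sub]
    abel

theorem gLie_anchor (M : ModuleCat.{u} (Ue k S L)) (α : L) (s : S) :
    gLie M α * homS k S (bimod k S) ((res k S L).obj M) s
      - homS k S (bimod k S) ((res k S L).obj M) s * gLie M α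
      = homS k S (bimod k S) ((res k S L).obj M) ⁅α, s⁆ := by
  ext φ v
  change commOp M α ((s ⊗ₜ[k] (1 : S) : Se k S) • φ v)
      - (s ⊗ₜ[k] (1 : S) : Se k S) • φ (anchorOp k α v)
      - (s ⊗ₜ[k] (1 : S) : Se k S) • (commOp M α (φ v) - φ (anchorOp k α v))
    = ((⁅α, s⁆ : S) ⊗ₜ[k] (1 : S) : Se k S) • φ v
  have e : anchorE k S α (s ⊗ₜ[k] (1 : S)) = (⁅α, s⁆ : S) ⊗ₜ[k] (1 : S) := by
    simp [anchorE]
  rw [commOp_isDeltaOperator M α, e, smul_sub]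
  abel

theorem gLie_smul (M : ModuleCat.{u} (Ue k S L)) (s : S) (α : L) :
    homS k S (bimod k S) ((res k S L).obj M) s * gLie M α = gLie M (s • α) :=
  gLieMap_smul M s α

/-- The `U`-module structure on `Hom_{S^e}(S, M)` given by the actions of `S` and `L`. -/
def gAct (M : ModuleCat.{u} (Ue k S L)) : Env k S L →ₐ[k] Module.End k (GHom M) :=
  Env.lift (homS k S (bimod k S) ((res k S L).obj M)) (gLie M) (gLie_smul M) (gLie_anchor M)

instance GHom.module (M : ModuleCat.{u} (Ue k S L)) : Module (Env k S L) (GHom M) :=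
  Module.compHom (GHom M) (gAct M).toRingHom

theorem GHom.i_smul {M : ModuleCat.{u} (Ue k S L)} (s : S) (φ : GHom M) :
    Env.i k S L s • φ = homS k S (bimod k S) ((res k S L).obj M) s φ :=
  congrArg (fun f : Module.End k (GHom M) => f φ)
    (Env.lift_i _ _ (gLie_smul M) (gLie_anchor M) s)

theorem GHom.j_smul {M : ModuleCat.{u} (Ue k S L)} (α : L) (φ : GHom M) :
    Env.j k S L α • φ = gLieMap M α φ :=
  congrArg (fun f : Module.End k (GHom M) => f φ)
    (Env.lift_j _ _ (gLie_smul M) (gLie_anchor M) α)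

/-- An element of `Hom_{S^e}(S, M)` as a morphism in the category of `S^e`-modules. -/
def GHom.toHom {M : ModuleCat.{u} (Ue k S L)} (φ : GHom M) : bimod k S ⟶ (res k S L).obj M :=
  ConcreteCategory.ofHom (C := ModuleCat.{u} (Se k S)) φ

/-- Postcomposition with a morphism of `U^e`-modules. -/
def GHom.map {M N : ModuleCat.{u} (Ue k S L)} (f : M ⟶ N) :
    GHom M →ₗ[Env k S L] GHom N where
  toFun φ := ((res k S L).map f).hom.comp φ
  map_add' φ ψ := LinearMap.comp_add _ _ _
  map_smul' u φ := by
    rw [RingHom.id_apply]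
    induction u using Env.induction generalizing φ with
    | hi s =>
      ext v
      simp only [GHom.i_smul, homS_apply, LinearMap.comp_apply, map_smul]
    | hj α =>
      ext v
      have h (m : M) : f.hom ((Env.j k S L α ⊗ₜ[k] (1 : (Env k S L)ᵐᵒᵖ) : Ue k S L) • m
          - ((1 : Env k S L) ⊗ₜ[k] MulOpposite.op (Env.j k S L α) : Ue k S L) • m) =
          (Env.j k S L α ⊗ₜ[k] (1 : (Env k S L)ᵐᵒᵖ) : Ue k S L) • f.hom m
          - ((1 : Env k S L) ⊗ₜ[k] MulOpposite.op (Env.j k S L α) : Ue k S L) • f.hom m := by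
        simp
      simp only [GHom.j_smul, gLieMap_apply, LinearMap.comp_apply, map_sub]
      congr 1
      exact h (φ v)
    | hadd u v hu hv => rw [add_smul, LinearMap.comp_add, hu, hv, add_smul]
    | hmul u v hu hv => rw [mul_smul, hu, hv, mul_smul]

variable (k S L) in
/-- The functor `G = Hom_{S^e}(S, -)` from `U^e`-modules to `U`-modules. -/
def G : ModuleCat.{u} (Ue k S L) ⥤ ModuleCat.{u} (Env k S L) where
  obj M := ModuleCat.of (Env k S L) (GHom M)
  map f := ModuleCat.ofHom (GHom.map f)

end Actions

/-! ### The two families of structures on `H^n(S, M)` -/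

section Structures

variable {k S L : Type u} [Field k] [CommRing S] [Algebra k S] [LieRing L] [LieAlgebra k L]
  [Module S L] [LieRingModule L S] [LieRinehartRing S L] [LieRinehartAlgebra k S L]
  {M : ModuleCat.{u} (Ue k S L)}

/-- A `U^e`-injective resolution of `M` whose terms are injective over `S^e`, regarded as an
`S^e`-injective resolution of `M`. -/
def restrictResolution (I : InjectiveResolution M)
    (hI : ∀ q, Injective ((res k S L).obj (I.cocomplex.X q))) :
    InjectiveResolution ((res k S L).obj M) where
  cocomplex := ((res k S L).mapHomologicalComplex _).obj I.cocomplex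
  injective := hI
  ι := (HomologicalComplex.singleMapHomologicalComplex _ _ _).inv.app _ ≫
    ((res k S L).mapHomologicalComplex _).map I.ι
  quasiIso := by
    have := (res k S L).preservesHomology_of_map_exact fun C hC => by
      rw [ShortComplex.ShortExact.moduleCat_exact_iff_function_exact] at hC ⊢
      exact hC
    infer_instance

/-- The class in `H^n(S, M)` of an `n`-cocycle `ψ` of the complex `G(I^•) = Hom_{S^e}(S, I^•)`. -/
def injClass (I : InjectiveResolution M)
    (hI : ∀ q, Injective ((res k S L).obj (I.cocomplex.X q))) (n : ℕ)
    (ψ : (G k S L).obj (I.cocomplex.X n))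
    (hψ : ((G k S L).map (I.cocomplex.d n (n + 1))).hom ψ = 0) : HH M n :=
  (restrictResolution I hI).extMk (GHom.toHom ψ) (n + 1) rfl (ModuleCat.hom_ext hψ)

/-- `ρ` is the `U`-module structure on `H^n(S, M)` induced by the `U`-module structure on the
complex `G(I^•)`: `u · [ψ] = [u · ψ]`. -/
def IsInducedByInjective (I : InjectiveResolution M)
    (hI : ∀ q, Injective ((res k S L).obj (I.cocomplex.X q))) (n : ℕ)
    (ρ : Env k S L →ₐ[k] Module.End k (HH M n)) : Prop :=
  ∀ (u : Env k S L) (ψ : (G k S L).obj (I.cocomplex.X n))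
    (hψ : ((G k S L).map (I.cocomplex.d n (n + 1))).hom ψ = 0),
    ρ u (injClass I hI n ψ hψ) =
      injClass I hI n (u • ψ) (by rw [map_smul, hψ, smul_zero])

/-- The class in `H^n(S, M)` of an `n`-cocycle `φ` of the complex `Hom_{S^e}(P_•, M)`. -/
def projClass (P : ProjectiveResolution (bimod k S)) (n : ℕ)
    (φ : P.complex.X n →ₗ[Se k S] (res k S L).obj M)
    (hφ : φ ∘ₗ (P.complex.d (n + 1) n).hom = 0) : HH M n :=
  P.extMk (ConcreteCategory.ofHom (C := ModuleCat.{u} (Se k S)) φ) (n + 1) rfl (ModuleCat.hom_ext hφ)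

/-- `ρ` is the `S`-module structure on `H^n(S, M)` induced by `(s · φ)(p) = s φ(p)` on
`Hom_{S^e}(P_•, M)`. -/
def IsInducedByProjectiveS (P : ProjectiveResolution (bimod k S)) (n : ℕ)
    (ρ : S →ₐ[k] Module.End k (HH M n)) : Prop :=
  ∀ (s : S) (φ : P.complex.X n →ₗ[Se k S] (res k S L).obj M)
    (hφ : φ ∘ₗ (P.complex.d (n + 1) n).hom = 0),
    ρ s (projClass P n φ hφ) =
      projClass P n (homS k S (P.complex.X n) ((res k S L).obj M) s φ) (by
        ext x
        have h := LinearMap.congr_fun hφ x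
        simp only [LinearMap.comp_apply, LinearMap.zero_apply] at h
        simp [homS_apply, h])

/-- An `α_S^e`-lifting of `α_S : S → S` to the resolution `P_•`. -/
abbrev AnchorLifting (α : L) (P : ProjectiveResolution (bimod k S)) : Type u :=
  DeltaLifting (anchorE k S α) (anchorOp k α) P

/-- The endomorphism `α^♯_q(φ) = (α ⊗ 1 - 1 ⊗ α) ∘ φ - φ ∘ α_q` of `Hom_{S^e}(P_q, M)`. -/
def alphaSharp {α : L} {P : ProjectiveResolution (bimod k S)} (a : AnchorLifting α P) (q : ℕ)
    (φ : P.complex.X q →ₗ[Se k S] (res k S L).obj M) :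
    P.complex.X q →ₗ[Se k S] (res k S L).obj M :=
  sharp (a.isDeltaOperator q) (commOp_isDeltaOperator M α) φ

theorem alphaSharp_comp_d {α : L} {P : ProjectiveResolution (bimod k S)} (a : AnchorLifting α P)
    (q : ℕ) (φ : P.complex.X q →ₗ[Se k S] (res k S L).obj M)
    (hφ : φ ∘ₗ (P.complex.d (q + 1) q).hom = 0) :
    alphaSharp a q φ ∘ₗ (P.complex.d (q + 1) q).hom = 0 := by
  ext x
  have h (y) := LinearMap.congr_fun hφ y
  simp only [LinearMap.comp_apply, LinearMap.zero_apply] at h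
  simp only [LinearMap.comp_apply, LinearMap.zero_apply, alphaSharp, sharp_apply, ← a.comm, h,
    map_zero, sub_zero]

/-- `ρ` is the `L`-module structure `α ↦ ∇_α` on `H^n(S, M)`, where `∇_α[φ] = [α^♯ φ]` for every
`α_S^e`-lifting of `α_S`. -/
def IsInducedByProjectiveL (P : ProjectiveResolution (bimod k S)) (n : ℕ)
    (ρ : L →ₗ⁅k⁆ Module.End k (HH M n)) : Prop :=
  ∀ (α : L) (a : AnchorLifting α P) (φ : P.complex.X n →ₗ[Se k S] (res k S L).obj M)
    (hφ : φ ∘ₗ (P.complex.d (n + 1) n).hom = 0),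
    ρ α (projClass P n φ hφ) = projClass P n (alphaSharp a n φ) (alphaSharp_comp_d a n φ hφ)

end Structures

end LieRinehart

end

/-! Two facts carry the theorem: injective `U^e`-modules stay injective over `S^e`, and the
operators coming from the two resolutions agree on `Ext`.

Restriction along `S^e → U^e` preserves injectives when its left adjoint `U^e ⊗ -` is exact, so it
suffices that `U^e` is projective as a right `S^e`-module (`projective_rightMod_seToUe`,
`injective_restrictScalars`). This follows once `U` is a retract of a free `S`-module on either
side. For `L` free this is Poincaré–Birkhoff–Witt: `L` acts on the free `S`-module on multisets of
basis indices (`actComm`), ordered monomials generate `U` over `S` (`toEnv_ofEnv`), and writing the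
scalars on the right instead of the left is a unitriangular change for the degree filtration
(`toEnvRight_bijective`). A projective `L` is a retract, as a Lie–Rinehart algebra, of `L ⋉ S^(κ)`,
which is `S`-free for `κ = ℕ × L` by Eilenberg's swindle; `U` is functorial, so the retraction
passes to enveloping algebras.

Liftings of `α_S` exist because projective modules carry operators over any derivation, and two such
operators differ by a linear map, which projectivity allows to be corrected
(`nonempty_deltaLifting`).

For the comparison, let `ε : P → S` and `η : M → I` be the augmentations. Cocycles `φ : P_n → M` and
`ψ : S → I^n` have the same class exactly when `η φ` and `ψ ε` differ by a coboundary of `Hom(P, I)`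
(`extMk_eq_extMk_iff`). A lifting on `P` and the operators `α ⊗ 1 - 1 ⊗ α` on `I` induce an operator
on `Hom(P, I)` that commutes with the differential and is compatible with both `η φ` and `ψ ε`.
Hence `[φ] = [ψ]` implies `[α^♯ φ] = [α · ψ]` (`projClass_alphaSharp_eq`). With `φ = 0` this shows
that `j(α)` acts on classes, while `i(s)` acts as the scalar `s ⊗ 1` of `Ext`. With `φ` arbitrary it
gives independence of the lifting and the equality of the structures. Uniqueness holds because every
class is represented by a cocycle on each side. -/

noncomputable section

namespace LieRinehart

set_option linter.unusedSectionVars false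

/-! ### The Poincaré–Birkhoff–Witt theorem for a free Lie–Rinehart algebra -/

section PBW

variable {k S L : Type u} [Field k] [CommRing S] [Algebra k S] [LieRing L] [LieAlgebra k L]
  [Module S L] [LieRingModule L S] [LieRinehartRing S L] [LieRinehartAlgebra k S L]
  {ι : Type u} [LinearOrder ι] (b : Module.Basis ι S L)

/-- The elements of degree `< n` of the free module on the monomials in the variables `ι`. -/
def degLT (S ι : Type u) [CommRing S] (n : ℕ) : Submodule S (Multiset ι →₀ S) :=
  Finsupp.supported S S {I | I.card < n}

/-- The monomial `z_I`. -/
def monom (S : Type u) {ι : Type u} [CommRing S] (I : Multiset ι) : Multiset ι →₀ S :=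
  Finsupp.single I 1

/-! ### Degree filtration of the free module on monomials. -/

section Monomials

variable {n m : ℕ}

theorem monom_mem_degLT {I : Multiset ι} (h : I.card < n) : monom S I ∈ degLT S ι n :=
  Finsupp.single_mem_supported S 1 h

theorem degLT_mono (h : n ≤ m) : degLT S ι n ≤ degLT S ι m :=
  Finsupp.supported_mono fun _ hI => lt_of_lt_of_le hI h

theorem exists_mem_degLT (v : Multiset ι →₀ S) : ∃ n, v ∈ degLT S ι n := by
  refine ⟨v.support.sup Multiset.card + 1, fun I hI => ?_⟩
  exact Nat.lt_succ_of_le (Finset.le_sup (f := Multiset.card) hI)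

theorem degLT_zero : degLT S ι 0 = ⊥ := by
  rw [degLT, eq_bot_iff, ← Finsupp.supported_empty (R := S)]
  exact Finsupp.supported_mono fun I hI => absurd hI (Nat.not_lt_zero _)

/-- Induction on the elements of degree `< n`. -/
theorem degLT_induction {C : (Multiset ι →₀ S) → Prop}
    (hz : ∀ I : Multiset ι, I.card < n → C (monom S I)) (h0 : C 0)
    (hadd : ∀ v w, C v → C w → C (v + w)) (hsmul : ∀ (s : S), ∀ v ∈ degLT S ι n, C v → C (s • v))
    {v : Multiset ι →₀ S} (hv : v ∈ degLT S ι n) : C v := by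
  rw [degLT, Finsupp.supported_eq_span_single] at hv
  induction hv using Submodule.span_induction with
  | mem x hx =>
    obtain ⟨I, hI, rfl⟩ := hx
    exact hz I hI
  | zero => exact h0
  | add x y _ _ hx hy => exact hadd x y hx hy
  | smul s x hx hx' => exact hsmul s x (by rwa [degLT, Finsupp.supported_eq_span_single]) hx'

end Monomials

theorem basis_induction {R X κ : Type*} [CommRing R] [AddCommGroup X] [Module R X]
    (b : Module.Basis κ R X) {C : X → Prop} (hb : ∀ i, C (b i)) (h0 : C 0)
    (hadd : ∀ x y, C x → C y → C (x + y)) (hsmul : ∀ (s : R) x, C x → C (s • x)) (x : X) :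
    C x := by
  have hx : x ∈ Submodule.span R (Set.range b) := by rw [b.span_eq]; trivial
  induction hx using Submodule.span_induction with
  | mem x hx => obtain ⟨i, rfl⟩ := hx; exact hb i
  | zero => exact h0
  | add x y _ _ hx hy => exact hadd x y hx hy
  | smul s x _ hx => exact hsmul s x hx

/-! ### Operators of `L` attached to a choice `r` of lower-order parts. -/

section Operators

variable (r : ι → Multiset ι → (Multiset ι →₀ S))

/-- The operator `s z_I ↦ s (z_{iI} + r i I) + b_i(s) z_I`. -/
def opOf (i : ι) : (Multiset ι →₀ S) →+ (Multiset ι →₀ S) :=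
  Finsupp.liftAddHom fun I =>
    { toFun := fun s => s • (monom S (i ::ₘ I) + r i I) + ⁅b i, s⁆ • monom S I
      map_zero' := by simp
      map_add' := fun s t => by simp only [add_smul, lie_add]; abel }

theorem opOf_single (i : ι) (I : Multiset ι) (s : S) :
    opOf b r i (Finsupp.single I s) =
      s • (monom S (i ::ₘ I) + r i I) + ⁅b i, s⁆ • monom S I := by
  simp [opOf]

theorem lie_one_eq_zero (α : L) : ⁅α, (1 : S)⁆ = 0 := by
  have h := LieRinehartRing.leibniz_mul_right α (1 : S) 1
  simpa using h

theorem opOf_monom (i : ι) (I : Multiset ι) :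
    opOf b r i (monom S I) = monom S (i ::ₘ I) + r i I := by
  rw [monom, opOf_single, lie_one_eq_zero, one_smul, zero_smul, add_zero]

theorem opOf_smul (i : ι) (s : S) (v : Multiset ι →₀ S) :
    opOf b r i (s • v) = s • opOf b r i v + ⁅b i, s⁆ • v := by
  induction v using Finsupp.induction_linear with
  | zero => simp
  | add v w hv hw => simp only [smul_add, map_add, hv, hw]; abel
  | single I t =>
    have e : (Finsupp.single I t : Multiset ι →₀ S) = t • monom S I :=
      (Finsupp.smul_single_one I t).symm
    rw [Finsupp.smul_single, smul_eq_mul, opOf_single, opOf_single,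
      LieRinehartRing.leibniz_mul_right, e]
    simp only [smul_add, add_smul, mul_smul, smul_assoc]
    abel

/-- The operator of `α ∈ L`, extending `opOf` linearly. -/
def actOf (α : L) : (Multiset ι →₀ S) →+ (Multiset ι →₀ S) where
  toFun v := b.constr S (fun i => opOf b r i v) α
  map_zero' := by
    have : (fun i => opOf b r i 0) = 0 := by ext1; simp
    rw [this, map_zero, LinearMap.zero_apply]
  map_add' v w := by
    have : (fun i => opOf b r i (v + w)) = (fun i => opOf b r i v) + fun i => opOf b r i w := by
      ext1; simp
    rw [this, map_add, LinearMap.add_apply]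

theorem actOf_basis (i : ι) (v : Multiset ι →₀ S) : actOf b r (b i) v = opOf b r i v :=
  b.constr_basis S _ i

theorem actOf_add_left (α β : L) (v : Multiset ι →₀ S) :
    actOf b r (α + β) v = actOf b r α v + actOf b r β v :=
  map_add (b.constr S fun i => opOf b r i v) α β

theorem actOf_zero_left (v : Multiset ι →₀ S) : actOf b r 0 v = 0 :=
  map_zero (b.constr S fun i => opOf b r i v)

theorem actOf_smul_left (s : S) (α : L) (v : Multiset ι →₀ S) :
    actOf b r (s • α) v = s • actOf b r α v :=
  map_smul (b.constr S fun i => opOf b r i v) s α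

theorem actOf_smul (α : L) (s : S) (v : Multiset ι →₀ S) :
    actOf b r α (s • v) = s • actOf b r α v + ⁅α, s⁆ • v := by
  induction α using basis_induction b with
  | hb i => rw [actOf_basis, actOf_basis, opOf_smul]
  | h0 => simp [actOf_zero_left]
  | hadd α β hα hβ => rw [actOf_add_left, actOf_add_left, hα, hβ, add_lie, add_smul, smul_add]; abel
  | hsmul t α hα =>
    rw [actOf_smul_left, actOf_smul_left, hα, LieRinehartRing.lie_smul_eq_mul, smul_add,
      smul_comm, mul_smul]

variable {r}

/-- Only the values of `r` on the monomials that occur matter. This locality lets the lower-order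
parts be built by recursion on the degree. -/
theorem opOf_congr {r' : ι → Multiset ι → (Multiset ι →₀ S)} {n : ℕ}
    (h : ∀ i I, I.card < n → r i I = r' i I) (i : ι) {v : Multiset ι →₀ S}
    (hv : v ∈ degLT S ι n) : opOf b r i v = opOf b r' i v := by
  refine degLT_induction (C := fun v => opOf b r i v = opOf b r' i v) (fun I hI => ?_) ?_
    (fun v w hv hw => ?_) (fun s v _ hv => ?_) hv
  · rw [opOf_monom, opOf_monom, h i I hI]
  · simp
  · rw [map_add, map_add, hv, hw]
  · rw [opOf_smul, opOf_smul, hv]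

theorem actOf_congr {r' : ι → Multiset ι → (Multiset ι →₀ S)} {n : ℕ}
    (h : ∀ i I, I.card < n → r i I = r' i I) (α : L) {v : Multiset ι →₀ S}
    (hv : v ∈ degLT S ι n) : actOf b r α v = actOf b r' α v := by
  have : (fun i => opOf b r i v) = fun i => opOf b r' i v :=
    funext fun i => opOf_congr b h i hv
  change b.constr S (fun i => opOf b r i v) α = b.constr S (fun i => opOf b r' i v) α
  rw [this]

theorem opOf_mem (hr : ∀ i I, r i I ∈ degLT S ι (I.card + 1)) (i : ι) {n : ℕ}
    {v : Multiset ι →₀ S} (hv : v ∈ degLT S ι n) : opOf b r i v ∈ degLT S ι (n + 1) := by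
  refine degLT_induction (C := fun v => opOf b r i v ∈ degLT S ι (n + 1)) (fun I hI => ?_) ?_
    (fun v w hv hw => ?_) (fun s v hv' hv => ?_) hv
  · rw [opOf_monom]
    exact add_mem (monom_mem_degLT (by simpa using hI)) (degLT_mono (by lia) (hr i I))
  · simp
  · rw [map_add]
    exact add_mem hv hw
  · rw [opOf_smul]
    exact add_mem (Submodule.smul_mem _ _ hv)
      (Submodule.smul_mem _ _ (degLT_mono (Nat.le_succ n) hv'))

theorem actOf_mem (hr : ∀ i I, r i I ∈ degLT S ι (I.card + 1)) (α : L) {n : ℕ}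
    {v : Multiset ι →₀ S} (hv : v ∈ degLT S ι n) : actOf b r α v ∈ degLT S ι (n + 1) := by
  induction α using basis_induction b with
  | hb i => rw [actOf_basis]; exact opOf_mem b hr i hv
  | h0 => rw [actOf_zero_left]; exact zero_mem _
  | hadd α β hα hβ => rw [actOf_add_left]; exact add_mem hα hβ
  | hsmul t α hα => rw [actOf_smul_left]; exact Submodule.smul_mem _ _ hα

end Operators

/-! ### Recursive construction of the lower-order parts. -/

/-- The lower-order part of `b_i z_I`, computed with recursion depth `n`. -/
def remAux : ℕ → ι → Multiset ι → (Multiset ι →₀ S)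
  | 0, _, _ => 0
  | n + 1, i, I =>
    match I.sort with
    | [] => 0
    -- The head `j` is the least index of `I`. If `j < i`, then `z_I = b_j z_t`, and the desired
    -- relation `b_i b_j z_t = b_j b_i z_t + [b_i, b_j] z_t` forces this value: `b_j` sends the
    -- leading term `z_{it}` of `b_i z_t` to `z_{iI}` with no remainder.
    | j :: t => if i ≤ j then 0 else
        opOf b (remAux n) j (remAux n i t) + actOf b (remAux n) ⁅b i, b j⁆ (monom S (t : Multiset ι))

theorem card_of_sort_eq_cons {I : Multiset ι} {j : ι} {t : List ι} (h : I.sort = j :: t) :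
    I.card = (t : Multiset ι).card + 1 := by
  rw [← Multiset.sort_eq I (· ≤ ·), h]
  simp

theorem remAux_mem (n : ℕ) : ∀ (i : ι) (I : Multiset ι),
    remAux b n i I ∈ degLT S ι (I.card + 1) := by
  induction n with
  | zero => exact fun _ _ => zero_mem _
  | succ n ih =>
    intro i I
    rw [remAux]
    split
    · exact zero_mem _
    · rename_i j t h
      rw [card_of_sort_eq_cons h]
      split
      · exact zero_mem _
      · exact add_mem (opOf_mem b ih j (ih i _))
          (actOf_mem b ih _ (monom_mem_degLT (Nat.lt_succ_self _)))

/-- Each recursive call concerns monomials of strictly smaller degree than `I`, so a depth of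
`I.card` already gives the final value. -/
theorem remAux_succ (n : ℕ) : ∀ (i : ι) (I : Multiset ι), I.card < n + 1 →
    remAux b (n + 1) i I = remAux b n i I := by
  induction n with
  | zero =>
    intro i I hI
    obtain rfl : I = 0 := Multiset.card_eq_zero.mp (by lia)
    simp [remAux]
  | succ n ih =>
    intro i I hI
    rw [remAux, remAux]
    split
    · rfl
    · rename_i j t h
      have ht := card_of_sort_eq_cons h
      have hlt : (t : Multiset ι).card < n + 1 := by lia
      split
      · rfl
      · rw [ih i t hlt, opOf_congr b ih j (degLT_mono hlt (remAux_mem b n i t)),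
          actOf_congr b ih _ (monom_mem_degLT hlt)]

/-- The lower-order part of `b_i z_I`. -/
def rem (i : ι) (I : Multiset ι) : Multiset ι →₀ S := remAux b I.card i I

theorem remAux_eq_rem {n : ℕ} (i : ι) (I : Multiset ι) (h : I.card < n + 1) :
    remAux b n i I = rem b i I := by
  obtain ⟨m, rfl⟩ := Nat.exists_eq_add_of_le (Nat.le_of_lt_succ h)
  clear h
  induction m with
  | zero => rfl
  | succ m ih => rw [← add_assoc, remAux_succ b _ i I (by lia), ih]

theorem rem_mem (i : ι) (I : Multiset ι) : rem b i I ∈ degLT S ι (I.card + 1) :=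
  remAux_mem b _ i I

theorem rem_of_le {i : ι} {I : Multiset ι} (h : ∀ j ∈ I, i ≤ j) : rem b i I = 0 := by
  rw [← remAux_eq_rem b (n := I.card + 1) i I (by lia), remAux]
  split
  · rfl
  · rename_i j t hI
    rw [if_pos]
    exact h j (by rw [← Multiset.mem_sort (r := (· ≤ ·)), hI]; simp)

/-- The defining recursion with the depth eliminated: all depths in play are beyond the point of
stabilisation. -/
theorem rem_cons {i j : ι} {J : Multiset ι} (hj : ∀ l ∈ J, j ≤ l) (hij : ¬ i ≤ j) :
    rem b i (j ::ₘ J) =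
      opOf b (rem b) j (rem b i J) + actOf b (rem b) ⁅b i, b j⁆ (monom S J) := by
  have h : ∀ i I, I.card < J.card + 1 → remAux b J.card i I = rem b i I :=
    fun i I hI => remAux_eq_rem b i I hI
  rw [← remAux_eq_rem b (n := J.card + 1) i _ (by simp), remAux, Multiset.sort_cons (r := (· ≤ ·)) j J hj]
  simp only [if_neg hij, Multiset.sort_eq]
  rw [h i J (by lia), opOf_congr b h j (rem_mem b i J),
    actOf_congr b h _ (monom_mem_degLT (by lia))]

/-- The operator by which `α ∈ L` acts on the free module on the monomials. -/
abbrev act (α : L) : (Multiset ι →₀ S) →+ (Multiset ι →₀ S) := actOf b (rem b) α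

theorem act_basis_monom (i : ι) (I : Multiset ι) :
    act b (b i) (monom S I) = monom S (i ::ₘ I) + rem b i I := by
  rw [act, actOf_basis, opOf_monom]

theorem act_basis_monom_of_le {i : ι} {I : Multiset ι} (h : ∀ j ∈ I, i ≤ j) :
    act b (b i) (monom S I) = monom S (i ::ₘ I) := by
  rw [act_basis_monom, rem_of_le b h, add_zero]

theorem act_mem (α : L) {n : ℕ} {v : Multiset ι →₀ S} (hv : v ∈ degLT S ι n) :
    act b α v ∈ degLT S ι (n + 1) :=
  actOf_mem b (rem_mem b) α hv

/-- True by construction: when the least index acts first, the remainder of `b_j z_{iI}` was chosen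
to make this hold. -/
theorem act_act_monom_of_le {i j : ι} {I : Multiset ι} (hij : i ≤ j) (h : ∀ l ∈ I, i ≤ l) :
    act b (b j) (act b (b i) (monom S I)) =
      act b (b i) (act b (b j) (monom S I)) + act b ⁅b j, b i⁆ (monom S I) := by
  rcases hij.eq_or_lt with rfl | hlt
  · simp [act, actOf_zero_left]
  · rw [act_basis_monom_of_le b h, act_basis_monom, act_basis_monom, rem_cons b h hlt.not_ge,
      map_add, act_basis_monom_of_le b, Multiset.cons_swap, ← actOf_basis]
    · abel
    · intro l hl
      rcases Multiset.mem_cons.mp hl with rfl | hl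
      exacts [hij, h l hl]

/-! ### The operators form a representation of `L`. -/

/-- The relation `[ρ(α), ρ(β)] v = ρ([α, β]) v`. -/
def ActComm (α β : L) (v : Multiset ι →₀ S) : Prop :=
  act b α (act b β v) = act b β (act b α v) + act b ⁅α, β⁆ v

variable {b} in
theorem ActComm.symm {α β : L} {v : Multiset ι →₀ S} (h : ActComm b α β v) :
    ActComm b β α v := by
  have e : act b ⁅β, α⁆ v = - act b ⁅α, β⁆ v := by
    rw [← lie_skew, ← neg_one_smul S, act, actOf_smul_left, neg_one_smul]
  rw [ActComm, h, e]
  abel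

/-- Replacing `β` by `s β` produces the anchor term `α(s) β v` on both sides, by the Leibniz rules
for the operators and for the bracket. Linearity in the other argument follows by symmetry. -/
theorem ActComm.of_basis {v : Multiset ι →₀ S} (h : ∀ i j, ActComm b (b i) (b j) v) (α β : L) :
    ActComm b α β v := by
  have right {α : L} (h : ∀ j, ActComm b α (b j) v) (β : L) : ActComm b α β v := by
    induction β using basis_induction b with
    | hb j => exact h j
    | h0 => simp [ActComm, act, actOf_zero_left]
    | hadd β γ hβ hγ =>
      simp only [ActComm, act, actOf_add_left, lie_add, map_add] at *
      rw [hβ, hγ]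
      abel
    | hsmul s β hβ =>
      simp only [ActComm, act, actOf_add_left, actOf_smul_left, actOf_smul,
        LieRinehartRing.leibniz_smul_right] at *
      rw [hβ, smul_add]
      abel
  exact right (fun j => (right (fun i => (h i j).symm) α).symm) β

/-- The mixed first-order terms cancel, and the remaining ones match because the anchor is a
morphism of Lie algebras. -/
theorem ActComm.smul {α β : L} {v : Multiset ι →₀ S} (h : ActComm b α β v) (s : S) :
    ActComm b α β (s • v) := by
  simp only [ActComm, act, actOf_smul, map_add, lie_lie, sub_smul] at *
  rw [h, smul_add]
  abel

theorem ActComm.add {α β : L} {v w : Multiset ι →₀ S} (hv : ActComm b α β v)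
    (hw : ActComm b α β w) : ActComm b α β (v + w) := by
  simp only [ActComm, map_add] at *
  rw [hv, hw]
  abel

theorem ActComm.of_monom {α β : L} {n : ℕ}
    (h : ∀ I : Multiset ι, I.card < n → ActComm b α β (monom S I))
    {v : Multiset ι →₀ S} (hv : v ∈ degLT S ι n) : ActComm b α β v :=
  degLT_induction h (by simp [ActComm]) (fun _ _ => ActComm.add b)
    (fun s _ _ hv => hv.smul b s) hv

/-- With `z_{lJ} = b_l z_J`, the operator `b_l` is moved to the far left of both `b_i b_j b_l z_J`
and `b_j b_i b_l z_J`. What remains is commutation on `z_J`, known by induction, and the Jacobi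
identity. -/
theorem actComm_monom_cons {i j l : ι} {J : Multiset ι} (hJ : ∀ m ∈ J, l ≤ m) (hi : l ≤ i)
    (hj : l ≤ j) (ih : ∀ v ∈ degLT S ι (J.card + 1), ∀ α β : L, ActComm b α β v) :
    ActComm b (b i) (b j) (monom S (l ::ₘ J)) := by
  have hz : monom S J ∈ degLT S ι (J.card + 1) := monom_mem_degLT (by lia)
  have key {i j : ι} (hi : l ≤ i) (hj : l ≤ j) :
      act b (b i) (act b (b j) (monom S (l ::ₘ J))) =
        act b (b l) (act b (b i) (act b (b j) (monom S J)))
        + act b ⁅b i, b l⁆ (act b (b j) (monom S J))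
        + act b ⁅b j, b l⁆ (act b (b i) (monom S J)) + act b ⁅b i, ⁅b j, b l⁆⁆ (monom S J) := by
    -- The leading term `z_{jJ}` of `b_j z_J` is out of reach of the induction hypothesis, but `l`
    -- is at most all its indices, so the case of a least index applies; the remainder has low
    -- enough degree for induction.
    have h1 : act b (b i) (act b (b l) (act b (b j) (monom S J))) =
        act b (b l) (act b (b i) (act b (b j) (monom S J)))
          + act b ⁅b i, b l⁆ (act b (b j) (monom S J)) := by
      rw [act_basis_monom]
      refine ActComm.add b ?_ (ih _ (rem_mem b j J) _ _)
      refine act_act_monom_of_le b hi fun m hm => ?_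
      rcases Multiset.mem_cons.mp hm with rfl | hm
      exacts [hj, hJ m hm]
    rw [← act_basis_monom_of_le b hJ, act_act_monom_of_le b hj hJ, map_add, h1,
      ih _ hz (b i) ⁅b j, b l⁆]
    abel
  have h2 := ih _ hz (b i) (b j)
  have h3 := ih _ hz (b l) ⁅b i, b j⁆
  have h4 : act b ⁅b i, ⁅b j, b l⁆⁆ (monom S J) = act b ⁅b j, ⁅b i, b l⁆⁆ (monom S J)
      - act b ⁅b l, ⁅b i, b j⁆⁆ (monom S J) := by
    rw [eq_sub_iff_add_eq, act, ← actOf_add_left]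
    congr 2
    rw [← sub_eq_zero, ← lie_jacobi (b i) (b j) (b l), ← lie_skew (b l) (b i), lie_neg]
    abel
  rw [ActComm, key hi hj, key hj hi, h2, map_add, h4,
    ← act_basis_monom_of_le b hJ, h3]
  abel

theorem actComm (α β : L) (v : Multiset ι →₀ S) : ActComm b α β v := by
  have main (n : ℕ) : ∀ v ∈ degLT S ι n, ∀ α β : L, ActComm b α β v := by
    induction n with
    | zero =>
      intro v hv
      rw [degLT_zero, Submodule.mem_bot] at hv
      simp [hv, ActComm]
    | succ n ih =>
      intro v hv α β
      refine ActComm.of_monom b (fun I hI => ActComm.of_basis b (fun i j => ?_) α β) hv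
      have main' {i j : ι} (hij : i ≤ j) : ActComm b (b j) (b i) (monom S I) := by
        by_cases h : ∀ l ∈ I, i ≤ l
        · exact act_act_monom_of_le b hij h
        -- Some index of `I` is below `i`, so the least index `l` of `I` satisfies `l ≤ i ≤ j` and
        -- can be split off.
        · rcases hs : I.sort with _ | ⟨l, t⟩
          · rw [← Multiset.sort_eq I (· ≤ ·), hs] at h
            simp at h
          · have hp := Multiset.pairwise_sort I (· ≤ ·)
            rw [hs, List.pairwise_cons] at hp
            have hIt : I = l ::ₘ (t : Multiset ι) := by
              rw [← Multiset.sort_eq I (· ≤ ·), hs]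
              rfl
            have hli : l ≤ i := by
              push Not at h
              obtain ⟨m, hm, hmi⟩ := h
              rw [hIt, Multiset.mem_cons] at hm
              rcases hm with rfl | hm
              exacts [hmi.le, (hp.1 m hm).trans hmi.le]
            have hc : (t : Multiset ι).card + 1 ≤ n := by
              have := card_of_sort_eq_cons hs
              lia
            rw [hIt]
            exact actComm_monom_cons b hp.1 (hli.trans hij) hli
              fun v hv => ih v (degLT_mono hc hv)
      rcases le_total i j with hij | hij
      exacts [(main' hij).symm, main' hij]
  obtain ⟨n, hn⟩ := exists_mem_degLT v
  exact main n v hn α β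

variable (k) in
/-- The operator of `α`, as a `k`-linear endomorphism. -/
def actEnd (α : L) : Module.End k (Multiset ι →₀ S) where
  toFun := act b α
  map_add' := map_add _
  map_smul' c v := by
    have h : ⁅α, algebraMap k S c⁆ = 0 :=
      (LieRinehartAlgebra.anchor k S L α).map_algebraMap c
    rw [← algebraMap_smul S c v, actOf_smul, h, zero_smul, add_zero, algebraMap_smul,
      RingHom.id_apply]

variable (k) in
/-- The representation of `L` on the free module on the monomials. -/
def actLie : L →ₗ⁅k⁆ Module.End k (Multiset ι →₀ S) where
  toFun := actEnd k b
  map_add' α β := LinearMap.ext fun v => actOf_add_left b (rem b) α β v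
  map_smul' c α := LinearMap.ext fun v => by
    have h := actOf_smul_left b (rem b) (algebraMap k S c) α v
    rw [algebraMap_smul, algebraMap_smul] at h
    exact h
  map_lie' {α β} := LinearMap.ext fun v => by
    rw [LieRing.of_associative_ring_bracket]
    exact eq_sub_of_add_eq' (Eq.symm (actComm b α β v))

variable (k) in
/-- The representation of `U(S, L)` on the free module on the monomials. -/
def actEnv : Env k S L →ₐ[k] Module.End k (Multiset ι →₀ S) :=
  Env.lift (Algebra.lsmul k k (Multiset ι →₀ S)) (actLie k b)
    (fun s α => LinearMap.ext fun v => (actOf_smul_left b (rem b) s α v).symm)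
    (fun α s => LinearMap.ext fun v => by
      have h : act b α (s • v) - s • act b α v = ⁅α, s⁆ • v :=
        sub_eq_of_eq_add' (actOf_smul b (rem b) α s v)
      exact h)

theorem actEnv_i (s : S) (v : Multiset ι →₀ S) : actEnv k b (Env.i k S L s) v = s • v := by
  rw [actEnv, Env.lift_i]
  rfl

theorem actEnv_j (α : L) (v : Multiset ι →₀ S) :
    actEnv k b (Env.j k S L α) v = act b α v := by
  rw [actEnv, Env.lift_j]
  rfl

/-! ### Ordered monomials in the enveloping algebra, with scalars on the left and on the right. -/

variable (k) in
/-- The ordered product of basis elements. -/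
def stdMonom (I : Multiset ι) : Env k S L := (I.sort.map fun i => Env.j k S L (b i)).prod

theorem stdMonom_cons {i : ι} {I : Multiset ι} (h : ∀ j ∈ I, i ≤ j) :
    stdMonom k b (i ::ₘ I) = Env.j k S L (b i) * stdMonom k b I := by
  rw [stdMonom, Multiset.sort_cons (r := (· ≤ ·)) i I h, List.map_cons, List.prod_cons, stdMonom]

theorem stdMonom_zero : stdMonom k b 0 = 1 := by
  simp [stdMonom]

theorem multiset_induction_le {C : Multiset ι → Prop} (h0 : C 0)
    (hcons : ∀ i I, (∀ j ∈ I, i ≤ j) → C I → C (i ::ₘ I)) (I : Multiset ι) : C I := by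
  rw [← Multiset.sort_eq I (· ≤ ·)]
  have hp := Multiset.pairwise_sort I (· ≤ ·)
  generalize I.sort = l at hp
  induction l with
  | nil => exact h0
  | cons i t ih =>
    rw [List.pairwise_cons] at hp
    exact hcons i t hp.1 (ih hp.2)

variable (k) in
/-- The map `s z_I ↦ i(s) x_I` to the enveloping algebra. -/
def toEnv : (Multiset ι →₀ S) →+ Env k S L :=
  Finsupp.liftAddHom fun I => (AddMonoidHom.mulRight (stdMonom k b I)).comp
    (Env.i k S L : S →+ Env k S L)

theorem toEnv_single (I : Multiset ι) (s : S) :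
    toEnv k b (Finsupp.single I s) = Env.i k S L s * stdMonom k b I := by
  simp [toEnv]

theorem toEnv_monom (I : Multiset ι) : toEnv k b (monom S I) = stdMonom k b I := by
  rw [monom, toEnv_single, map_one, one_mul]

theorem toEnv_smul (s : S) (v : Multiset ι →₀ S) :
    toEnv k b (s • v) = Env.i k S L s * toEnv k b v := by
  induction v using Finsupp.induction_linear with
  | zero => simp
  | add v w hv hw => simp only [smul_add, map_add, hv, hw, mul_add]
  | single I t =>
    rw [Finsupp.smul_single, toEnv_single, toEnv_single, smul_eq_mul, map_mul, mul_assoc]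

theorem toEnv_act_of_basis {v : Multiset ι →₀ S}
    (h : ∀ i, toEnv k b (act b (b i) v) = Env.j k S L (b i) * toEnv k b v) (α : L) :
    toEnv k b (act b α v) = Env.j k S L α * toEnv k b v := by
  induction α using basis_induction b with
  | hb i => exact h i
  | h0 => simp [act, actOf_zero_left]
  | hadd α β hα hβ => rw [act, actOf_add_left, map_add, hα, hβ, map_add, add_mul]
  | hsmul s α hα =>
    rw [act, actOf_smul_left, toEnv_smul, hα, ← mul_assoc, Env.i_mul_j]

theorem toEnv_act_of_monom {n : ℕ} {α : L} (h : ∀ I : Multiset ι, I.card < n →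
      toEnv k b (act b α (monom S I)) = Env.j k S L α * toEnv k b (monom S I))
    {v : Multiset ι →₀ S} (hv : v ∈ degLT S ι n) :
    toEnv k b (act b α v) = Env.j k S L α * toEnv k b v := by
  refine degLT_induction (C := fun v => toEnv k b (act b α v) = Env.j k S L α * toEnv k b v)
    h (by simp) (fun v w hv hw => ?_) (fun s v _ hv => ?_) hv
  · rw [map_add, map_add, hv, hw, map_add, mul_add]
  · rw [actOf_smul, map_add, toEnv_smul, toEnv_smul, toEnv_smul, hv, ← mul_assoc, ← mul_assoc,
      Env.j_mul_i, add_mul]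

/-- For an index below all of `I`, this is the definition of the ordered product. Otherwise `b_i` is
commuted past the least factor, by the same relation in the module and in `U`, and the degree drops.
-/
theorem toEnv_act (α : L) (v : Multiset ι →₀ S) :
    toEnv k b (act b α v) = Env.j k S L α * toEnv k b v := by
  have main (n : ℕ) : ∀ v ∈ degLT S ι n, ∀ α : L,
      toEnv k b (act b α v) = Env.j k S L α * toEnv k b v := by
    induction n with
    | zero =>
      intro v hv
      rw [degLT_zero, Submodule.mem_bot] at hv
      simp [hv]
    | succ n ih =>
      intro v hv α
      refine toEnv_act_of_monom b (fun I hI => toEnv_act_of_basis b (fun i => ?_) α) hv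
      have le_case {i : ι} {I : Multiset ι} (h : ∀ j ∈ I, i ≤ j) :
          toEnv k b (act b (b i) (monom S I)) = Env.j k S L (b i) * toEnv k b (monom S I) := by
        rw [act_basis_monom_of_le b h, toEnv_monom, toEnv_monom, stdMonom_cons b h]
      clear hv v α
      revert hI
      refine multiset_induction_le (C := fun I => I.card < n + 1 → toEnv k b
        (act b (b i) (monom S I)) = Env.j k S L (b i) * toEnv k b (monom S I)) ?_ ?_ I
      · exact fun _ => le_case (by simp)
      · intro j J hj _ hJ
        rw [Multiset.card_cons] at hJ
        by_cases hij : i ≤ j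
        · refine le_case fun l hl => ?_
          rcases Multiset.mem_cons.mp hl with rfl | hl
          exacts [hij, hij.trans (hj l hl)]
        · have hz : monom S J ∈ degLT S ι n := monom_mem_degLT (by lia)
          -- `j` is at most all indices of the leading term `z_{iJ}`, and the remainder is covered
          -- by induction on the degree.
          have h1 : toEnv k b (act b (b j) (act b (b i) (monom S J))) =
              Env.j k S L (b j) * toEnv k b (act b (b i) (monom S J)) := by
            rw [act_basis_monom, map_add, map_add, le_case, map_add, mul_add,
              ih _ (degLT_mono (by lia) (rem_mem b i J))]
            intro l hl
            rcases Multiset.mem_cons.mp hl with rfl | hl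
            exacts [(not_le.mp hij).le, hj l hl]
          rw [← act_basis_monom_of_le b hj, actComm b, map_add, h1, ih _ hz, ih _ hz, ih _ hz,
            LieHom.map_lie, LieRing.of_associative_ring_bracket]
          noncomm_ring
  obtain ⟨n, hn⟩ := exists_mem_degLT v
  exact main n v hn α

theorem toEnv_actEnv (u : Env k S L) (v : Multiset ι →₀ S) :
    toEnv k b (actEnv k b u v) = u * toEnv k b v := by
  induction u using Env.induction generalizing v with
  | hi s => rw [actEnv_i, toEnv_smul]
  | hj α => rw [actEnv_j, toEnv_act]
  | hadd u u' hu hu' => rw [map_add, LinearMap.add_apply, map_add, hu, hu', add_mul]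
  | hmul u u' hu hu' => rw [map_mul, Module.End.mul_apply, hu, hu', mul_assoc]

variable (k) in
/-- The symbol map `u ↦ u · z_∅`. -/
def ofEnv : Env k S L →+ (Multiset ι →₀ S) where
  toFun u := actEnv k b u (monom S 0)
  map_zero' := by simp
  map_add' := by simp

theorem ofEnv_mul (u u' : Env k S L) : ofEnv k b (u * u') = actEnv k b u (ofEnv k b u') := by
  simp [ofEnv]

/-- Equivariance applied to `z_∅`, whose image is `1`. Since both maps respect left multiplication
by `S`, this already exhibits `U` as a retract of a free left `S`-module. -/
theorem toEnv_ofEnv (u : Env k S L) : toEnv k b (ofEnv k b u) = u := by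
  change toEnv k b (actEnv k b u (monom S 0)) = u
  rw [toEnv_actEnv, toEnv_monom, stdMonom_zero, mul_one]

theorem ofEnv_i_mul (s : S) (u : Env k S L) :
    ofEnv k b (Env.i k S L s * u) = s • ofEnv k b u := by
  rw [ofEnv_mul, actEnv_i]

variable (k) in
/-- The map `s z_I ↦ x_I i(s)` to the enveloping algebra. -/
def toEnvRight : (Multiset ι →₀ S) →+ Env k S L :=
  Finsupp.liftAddHom fun I => (AddMonoidHom.mulLeft (stdMonom k b I)).comp
    (Env.i k S L : S →+ Env k S L)

theorem toEnvRight_single (I : Multiset ι) (s : S) :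
    toEnvRight k b (Finsupp.single I s) = stdMonom k b I * Env.i k S L s := by
  simp [toEnvRight]

theorem toEnvRight_smul (s : S) (v : Multiset ι →₀ S) :
    toEnvRight k b (s • v) = toEnvRight k b v * Env.i k S L s := by
  induction v using Finsupp.induction_linear with
  | zero => simp
  | add v w hv hw => simp only [smul_add, map_add, hv, hw, add_mul]
  | single I t =>
    rw [Finsupp.smul_single, toEnvRight_single, toEnvRight_single, smul_eq_mul, mul_comm, map_mul,
      mul_assoc]

/-- Carrying `s` leftwards across a factor `b_i` costs only the term with `b_i(s)`, in which that
factor has disappeared. -/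
theorem ofEnv_stdMonom_mul_i_sub_mem (I : Multiset ι) (s : S) :
    ofEnv k b (stdMonom k b I * Env.i k S L s) - s • monom S I ∈ degLT S ι I.card := by
  refine multiset_induction_le (C := fun I => ofEnv k b (stdMonom k b I * Env.i k S L s)
    - s • monom S I ∈ degLT S ι I.card) ?_ ?_ I
  · have h : ofEnv k b (stdMonom k b 0 * Env.i k S L s) = s • monom S 0 := by
      rw [stdMonom_zero, one_mul]
      exact actEnv_i b s _
    rw [h, sub_self]
    exact zero_mem _
  · intro i I h ih
    have e : ofEnv k b (stdMonom k b (i ::ₘ I) * Env.i k S L s) - s • monom S (i ::ₘ I) =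
        act b (b i) (ofEnv k b (stdMonom k b I * Env.i k S L s) - s • monom S I)
          + ⁅b i, s⁆ • monom S I := by
      rw [stdMonom_cons b h, mul_assoc, ofEnv_mul, actEnv_j, map_sub, actOf_smul,
        act_basis_monom_of_le b h]
      abel
    rw [e, Multiset.card_cons]
    exact add_mem (act_mem b _ ih) (Submodule.smul_mem _ _ (monom_mem_degLT (Nat.lt_succ_self _)))

theorem ofEnv_toEnvRight_sub_mem {n : ℕ} {v : Multiset ι →₀ S} (hv : v ∈ degLT S ι (n + 1)) :
    ofEnv k b (toEnvRight k b v) - v ∈ degLT S ι n := by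
  rw [← v.sum_single, Finsupp.sum, map_sum, map_sum, ← Finset.sum_sub_distrib]
  refine sum_mem fun I hI => ?_
  have e : Finsupp.single I (v I) = v I • monom S I := (Finsupp.smul_single_one I (v I)).symm
  rw [toEnvRight_single, e]
  exact degLT_mono (Nat.le_of_lt_succ (hv hI)) (ofEnv_stdMonom_mul_i_sub_mem b I (v I))

/-- The composite with `ofEnv` is the identity up to terms of lower degree, so an element of the
kernel has its degree lowered indefinitely. -/
theorem toEnvRight_injective : Function.Injective (toEnvRight k b) := by
  rw [injective_iff_map_eq_zero]
  intro v hv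
  obtain ⟨n, hn⟩ := exists_mem_degLT v
  induction n with
  | zero => rwa [degLT_zero, Submodule.mem_bot] at hn
  | succ n ih =>
    have h := ofEnv_toEnvRight_sub_mem (k := k) b hn
    rw [hv, map_zero, zero_sub, neg_mem_iff] at h
    exact ih h

theorem ofEnv_toEnvRight_surjective (v : Multiset ι →₀ S) :
    ∃ w, ofEnv k b (toEnvRight k b w) = v := by
  obtain ⟨n, hn⟩ := exists_mem_degLT v
  induction n generalizing v with
  | zero =>
    rw [degLT_zero, Submodule.mem_bot] at hn
    exact ⟨0, by simp [hn]⟩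
  | succ n ih =>
    obtain ⟨w, hw⟩ := ih _ (ofEnv_toEnvRight_sub_mem (k := k) b hn)
    exact ⟨v - w, by rw [map_sub, map_sub, hw]; abel⟩

theorem toEnvRight_bijective : Function.Bijective (toEnvRight k b) := by
  refine ⟨toEnvRight_injective b, fun u => ?_⟩
  obtain ⟨w, hw⟩ := ofEnv_toEnvRight_surjective (k := k) b (ofEnv k b u)
  exact ⟨w, Function.LeftInverse.injective (toEnv_ofEnv b) hw⟩


end PBW

/-! ### Embedding a projective Lie–Rinehart algebra as a retract of a free one -/

section Swindle

variable {R X F : Type u} [CommRing R] [AddCommGroup X] [Module R X] [AddCommGroup F] [Module R F]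

/-- Eilenberg's swindle: a retract `X` of `F` is absorbed by `F ⊕ F ⊕ ⋯`. -/
def eilenbergSwindle (σ : X →ₗ[R] F) (π : F →ₗ[R] X) (h : ∀ x, π (σ x) = x) :
    (X × (ℕ →₀ F)) ≃ₗ[R] (ℕ →₀ F) :=
  LinearEquiv.ofLinearMap
    -- Each copy of `F` splits as `X ⊕ ker π`. The `X`-parts are shifted by one place, making room
    -- for the extra `X` in place `0`; the `ker π`-parts stay.
    (((Finsupp.lsingle 0 : F →ₗ[R] ℕ →₀ F) ∘ₗ σ).coprod
      (Finsupp.lmapDomain F R Nat.succ ∘ₗ Finsupp.mapRange.linearMap (σ ∘ₗ π)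
        + Finsupp.mapRange.linearMap (LinearMap.id - σ ∘ₗ π)))
    ((π ∘ₗ Finsupp.lapply 0).prod
      (Finsupp.mapRange.linearMap (LinearMap.id - σ ∘ₗ π)
        + Finsupp.mapRange.linearMap (σ ∘ₗ π) ∘ₗ
          Finsupp.lcomapDomain Nat.succ Nat.succ_injective))
    (by
      refine LinearMap.ext fun g => Finsupp.ext fun n => ?_
      cases n with
      | zero =>
        simp [Finsupp.mapDomain_of_notMem_range, Finsupp.lcomapDomain, h]
      | succ n =>
        have := fun g : ℕ →₀ F => Finsupp.mapDomain_apply Nat.succ_injective g n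
        simp only [Nat.succ_eq_add_one] at this
        simp [this, Finsupp.lcomapDomain, h])
    (by
      refine LinearMap.ext fun ⟨x, f⟩ => ?_
      have h0 (g : ℕ →₀ F) : Finsupp.mapDomain Nat.succ g 0 = 0 :=
        Finsupp.mapDomain_of_notMem_range g 0 (by simp)
      have hs := fun (g : ℕ →₀ F) n => Finsupp.mapDomain_apply Nat.succ_injective g n
      simp only [Nat.succ_eq_add_one] at hs
      refine Prod.ext ?_ (Finsupp.ext fun n => ?_)
      · simp [h0, h]
      · cases n with
        | zero => simp [h0, hs, h, Finsupp.lcomapDomain]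
        | succ n => simp [hs, h, Finsupp.lcomapDomain])

end Swindle

/-! ### The extension `L ⋉ S^(κ)`, free over `S` for suitable `κ`. -/

section FreeExtension

variable (k S L κ : Type u) [Field k] [CommRing S] [Algebra k S] [LieRing L] [LieAlgebra k L]
  [Module S L] [LieRingModule L S] [LieRinehartRing S L] [LieRinehartAlgebra k S L]

/-- The semidirect product of `L` with the abelian ideal `S^(κ)`, on which `L` acts
coefficientwise. -/
def FreeExt : Type u := L × (κ →₀ S)

namespace FreeExt

instance : AddCommGroup (FreeExt S L κ) := inferInstanceAs (AddCommGroup (L × (κ →₀ S)))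

instance : Module S (FreeExt S L κ) := inferInstanceAs (Module S (L × (κ →₀ S)))

instance : Module k (FreeExt S L κ) := inferInstanceAs (Module k (L × (κ →₀ S)))

variable {S L κ}

@[ext]
theorem ext {x y : FreeExt S L κ} (h1 : x.1 = y.1) (h2 : ∀ a, x.2 a = y.2 a) : x = y :=
  Prod.ext h1 (Finsupp.ext h2)

/-- The coefficientwise action of `L` on `S^(κ)`. -/
def coeffLie (α : L) : (κ →₀ S) →+ (κ →₀ S) :=
  Finsupp.mapRange.addMonoidHom (LieRingModule.toEnd L S α : S →+ S)

instance : Bracket (FreeExt S L κ) (FreeExt S L κ) where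
  bracket x y := (⁅x.1, y.1⁆, coeffLie x.1 y.2 - coeffLie y.1 x.2)

theorem fst_lie (x y : FreeExt S L κ) : ⁅x, y⁆.1 = ⁅x.1, y.1⁆ := rfl

theorem snd_lie (x y : FreeExt S L κ) (a : κ) :
    ⁅x, y⁆.2 a = ⁅x.1, y.2 a⁆ - ⁅y.1, x.2 a⁆ := rfl

theorem fst_add (x y : FreeExt S L κ) : (x + y).1 = x.1 + y.1 := rfl

theorem snd_add (x y : FreeExt S L κ) (a : κ) : (x + y).2 a = x.2 a + y.2 a := rfl

theorem fst_smul (s : S) (x : FreeExt S L κ) : (s • x).1 = s • x.1 := rfl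

theorem snd_smul (s : S) (x : FreeExt S L κ) (a : κ) : (s • x).2 a = s * x.2 a := rfl

instance : LieRing (FreeExt S L κ) where
  add_lie x y z := by
    ext
    · simp only [fst_lie, fst_add, add_lie]
    · simp only [snd_lie, fst_add, snd_add, add_lie, lie_add]
      abel
  lie_add x y z := by
    ext
    · simp only [fst_lie, fst_add, lie_add]
    · simp only [snd_lie, fst_add, snd_add, add_lie, lie_add]
      abel
  lie_self x := by
    ext
    · exact lie_self x.1
    · exact sub_self _
  leibniz_lie x y z := by
    ext
    · simp only [fst_lie, fst_add, leibniz_lie x.1]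
    · simp only [snd_lie, fst_lie, snd_add, lie_sub, lie_lie]
      abel

instance : LieAlgebra k (FreeExt S L κ) where
  lie_smul c x y := by
    have h (a : κ) : ⁅x.1, c • y.2 a⁆ - ⁅c • y.1, x.2 a⁆ =
        c • (⁅x.1, y.2 a⁆ - ⁅y.1, x.2 a⁆) := by
      have h1 : ⁅x.1, c • y.2 a⁆ = c • ⁅x.1, y.2 a⁆ :=
        map_smul (LieRinehartAlgebra.anchor k S L x.1 : S →ₗ[k] S) c (y.2 a)
      rw [h1, ← algebraMap_smul S c y.1, LieRinehartRing.lie_smul_eq_mul, smul_sub,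
        ← Algebra.smul_def]
    ext a
    · exact lie_smul c x.1 y.1
    · exact h a

instance : LieRingModule (FreeExt S L κ) S where
  bracket x s := ⁅x.1, s⁆
  add_lie x y s := add_lie x.1 y.1 s
  lie_add x s t := lie_add x.1 s t
  leibniz_lie x y s := leibniz_lie x.1 y.1 s

theorem lie_eq (x : FreeExt S L κ) (s : S) : ⁅x, s⁆ = ⁅x.1, s⁆ := rfl

instance : LieRinehartRing S (FreeExt S L κ) where
  lie_smul_eq_mul' s t x := LieRinehartRing.lie_smul_eq_mul s t x.1
  leibniz_mul_right' x s t := LieRinehartRing.leibniz_mul_right x.1 s t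
  leibniz_smul_right' x y s := by
    ext
    · simp only [fst_lie, fst_smul, fst_add, LieRinehartRing.leibniz_smul_right, lie_eq]
    · simp only [snd_lie, snd_smul, snd_add, fst_smul, LieRinehartRing.leibniz_mul_right,
        LieRinehartRing.lie_smul_eq_mul, lie_eq, smul_eq_mul]
      ring

instance : LieRinehartAlgebra k S (FreeExt S L κ) where
  smul_assoc c s x := by
    have h : (c • s) • (show L × (κ →₀ S) from x) = c • s • (show L × (κ →₀ S) from x) :=
      Prod.ext (smul_assoc c s x.1) (smul_assoc c s x.2)
    exact h
  smul_lie c x s := by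
    have h : ⁅c • x.1, s⁆ = c • ⁅x.1, s⁆ := by
      rw [← algebraMap_smul S c x.1, LieRinehartRing.lie_smul_eq_mul, ← Algebra.smul_def]
    exact h
  lie_smul c x s := map_smul (LieRinehartAlgebra.anchor k S L x.1 : S →ₗ[k] S) c s

variable (κ) in
/-- The inclusion `L → L ⋉ S^(κ)`. -/
def incl : L →ₗ⁅k⁆ FreeExt S L κ :=
  { (LinearMap.inl k L (κ →₀ S) : L →ₗ[k] L × (κ →₀ S)) with
    map_lie' := fun {α β} => by
      refine FreeExt.ext rfl fun a => ?_
      change (0 : S) = ⁅α, (0 : S)⁆ - ⁅β, (0 : S)⁆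
      simp }

/-- The projection `L ⋉ S^(κ) → L`. -/
def proj : FreeExt S L κ →ₗ⁅k⁆ L :=
  { (LinearMap.fst k L (κ →₀ S) : L × (κ →₀ S) →ₗ[k] L) with
    map_lie' := rfl }

/-- `L` is a retract of `F = S^(L)`, and `S^(ℕ × L)` is `F ⊕ F ⊕ ⋯`, which absorbs `L` by the
swindle. -/
theorem nonempty_basis [Module.Projective S L] :
    Nonempty (Module.Basis (ℕ × L) S (FreeExt S L (ℕ × L))) := by
  obtain ⟨σ, hσ⟩ := Module.projective_def'.mp (inferInstance : Module.Projective S L)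
  have e := eilenbergSwindle σ (Finsupp.linearCombination S id) fun x => LinearMap.congr_fun hσ x
  let c := Finsupp.curryLinearEquiv (α := ℕ) (β := L) (M := S) S
  exact ⟨.ofRepr ((((LinearEquiv.refl S L).prodCongr c).trans e).trans c.symm)⟩

end FreeExt

end FreeExtension

/-! ### Enveloping algebras as retracts of free `S`-modules. -/

section Retract

variable {k S L : Type u} [Field k] [CommRing S] [Algebra k S] [LieRing L] [LieAlgebra k L]
  [Module S L] [LieRingModule L S] [LieRinehartRing S L]
  {L' : Type u} [LieRing L'] [LieAlgebra k L'] [Module S L'] [LieRingModule L' S]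
  [LieRinehartRing S L'] [LieRinehartAlgebra k S L'] [LieRinehartAlgebra k S L]

/-- The functoriality of the enveloping algebra in `L`. -/
def Env.map (F : L →ₗ⁅k⁆ L') (hsmul : ∀ (s : S) α, F (s • α) = s • F α)
    (hlie : ∀ α (s : S), ⁅F α, s⁆ = ⁅α, s⁆) : Env k S L →ₐ[k] Env k S L' :=
  Env.lift (Env.i k S L') ((Env.j k S L').comp F)
    (fun s α => by rw [LieHom.comp_apply, LieHom.comp_apply, hsmul, Env.i_mul_j])
    (fun α s => by rw [LieHom.comp_apply, Env.j_mul_i, add_sub_cancel_left, hlie])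

section

variable (F : L →ₗ⁅k⁆ L') (hsmul : ∀ (s : S) α, F (s • α) = s • F α)
  (hlie : ∀ α (s : S), ⁅F α, s⁆ = ⁅α, s⁆)

theorem Env.map_i (s : S) : Env.map F hsmul hlie (Env.i k S L s) = Env.i k S L' s :=
  Env.lift_i _ _ _ _ s

theorem Env.map_j (α : L) : Env.map F hsmul hlie (Env.j k S L α) = Env.j k S L' (F α) :=
  Env.lift_j _ _ _ _ α

theorem Env.map_map_eq_self (F' : L' →ₗ⁅k⁆ L) (hsmul' : ∀ (s : S) α, F' (s • α) = s • F' α)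
    (hlie' : ∀ α (s : S), ⁅F' α, s⁆ = ⁅α, s⁆) (h : ∀ α, F' (F α) = α) (u : Env k S L) :
    Env.map F' hsmul' hlie' (Env.map F hsmul hlie u) = u := by
  induction u using Env.induction with
  | hi s => rw [Env.map_i, Env.map_i]
  | hj α => rw [Env.map_j, Env.map_j, h]
  | hadd u v hu hv => rw [map_add, map_add, hu, hv]
  | hmul u v hu hv => rw [map_mul, map_mul, hu, hv]

end

-- The inclusion and the projection between `L` and `L ⋉ S^(κ)` are `S`-linear and respect brackets
-- and anchors, so functoriality applies to both.
variable (k S L) in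
theorem exists_env_freeExt_retract (κ : Type u) :
    ∃ (inc : Env k S L →ₐ[k] Env k S (FreeExt S L κ)) (pr : Env k S (FreeExt S L κ) →ₐ[k] Env k S L),
      (∀ u, pr (inc u) = u) ∧ (∀ s, inc (Env.i k S L s) = Env.i k S _ s) ∧
        ∀ s, pr (Env.i k S _ s) = Env.i k S L s :=
  ⟨Env.map (FreeExt.incl k κ) (fun s _ => FreeExt.ext rfl fun _ => (mul_zero s).symm)
      (fun _ _ => rfl),
    Env.map (FreeExt.proj k) (fun _ _ => rfl) (fun _ _ => rfl),
    Env.map_map_eq_self _ _ _ _ _ _ fun _ => rfl, Env.map_i _ _ _, Env.map_i _ _ _⟩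

variable (k S L) in
/-- The enveloping algebra is a retract of a free `S`-module, for its left module structure. -/
theorem exists_left_retract [Module.Projective S L] :
    ∃ (κ : Type u) (p : Env k S L →ₗ[k] κ →₀ S) (q : (κ →₀ S) →ₗ[k] Env k S L),
      (∀ u, q (p u) = u) ∧ (∀ s u, p (Env.i k S L s * u) = s • p u) ∧
        ∀ s v, q (s • v) = Env.i k S L s * q v := by
  classical
  obtain ⟨b⟩ := FreeExt.nonempty_basis (S := S) (L := L)
  let := linearOrderOfSTO (WellOrderingRel (α := ℕ × L))
  obtain ⟨inc, pr, hpr, hinc_i, hpr_i⟩ := exists_env_freeExt_retract k S L (ℕ × L)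
  have hp (s : S) (u : Env k S L) : ofEnv k b (inc (Env.i k S L s * u)) =
      s • ofEnv k b (inc u) := by
    rw [map_mul, hinc_i, ofEnv_i_mul]
  have hq (s : S) (v : Multiset (ℕ × L) →₀ S) : pr (toEnv k b (s • v)) =
      Env.i k S L s * pr (toEnv k b v) := by
    rw [toEnv_smul, map_mul, hpr_i]
  refine ⟨Multiset (ℕ × L),
    { toFun := fun u => ofEnv k b (inc u), map_add' := by simp, map_smul' := fun c u => ?_ },
    { toFun := fun v => pr (toEnv k b v), map_add' := by simp, map_smul' := fun c v => ?_ },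
    fun u => ?_, hp, hq⟩
  · rw [Algebra.smul_def, ← AlgHom.commutes (Env.i k S L), hp, algebraMap_smul, RingHom.id_apply]
  · rw [← algebraMap_smul S c v, hq, AlgHom.commutes, ← Algebra.smul_def, RingHom.id_apply]
  · change pr (toEnv k b (ofEnv k b (inc u))) = u
    rw [toEnv_ofEnv]
    exact hpr u

variable (k S L) in
/-- The enveloping algebra is a retract of a free `S`-module, for its right module structure. -/
theorem exists_right_retract [Module.Projective S L] :
    ∃ (κ : Type u) (p : Env k S L →ₗ[k] κ →₀ S) (q : (κ →₀ S) →ₗ[k] Env k S L),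
      (∀ u, q (p u) = u) ∧ (∀ s u, p (u * Env.i k S L s) = s • p u) ∧
        ∀ s v, q (s • v) = q v * Env.i k S L s := by
  classical
  obtain ⟨b⟩ := FreeExt.nonempty_basis (S := S) (L := L)
  let := linearOrderOfSTO (WellOrderingRel (α := ℕ × L))
  obtain ⟨inc, pr, hpr, hinc_i, hpr_i⟩ := exists_env_freeExt_retract k S L (ℕ × L)
  -- `ofEnv` is linear only for the left action of `S`; a section linear for the right action
  -- requires the inverse of `toEnvRight`.
  let e := AddEquiv.ofBijective (toEnvRight k b) (toEnvRight_bijective b)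
  have he (s : S) u : e.symm (u * Env.i k S _ s) = s • e.symm u := by
    rw [AddEquiv.symm_apply_eq]
    change _ = toEnvRight k b (s • e.symm u)
    rw [toEnvRight_smul]
    exact congrArg (· * Env.i k S _ s) (e.apply_symm_apply u).symm
  have hp (s : S) (u : Env k S L) : e.symm (inc (u * Env.i k S L s)) = s • e.symm (inc u) := by
    rw [map_mul, hinc_i, he]
  have hq (s : S) (v : Multiset (ℕ × L) →₀ S) : pr (toEnvRight k b (s • v)) =
      pr (toEnvRight k b v) * Env.i k S L s := by
    rw [toEnvRight_smul, map_mul, hpr_i]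
  refine ⟨Multiset (ℕ × L),
    { toFun := fun u => e.symm (inc u), map_add' := by simp, map_smul' := fun c u => ?_ },
    { toFun := fun v => pr (toEnvRight k b v), map_add' := by simp, map_smul' := fun c v => ?_ },
    fun u => ?_, hp, hq⟩
  · rw [Algebra.smul_def, Algebra.commutes, ← AlgHom.commutes (Env.i k S L), hp, algebraMap_smul,
      RingHom.id_apply]
  · rw [← algebraMap_smul S c v, hq, AlgHom.commutes, ← Algebra.commutes, ← Algebra.smul_def,
      RingHom.id_apply]
  · change pr (e (e.symm (inc u))) = u
    rw [AddEquiv.apply_symm_apply]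
    exact hpr u

end Retract

/-! ### Restriction of injective modules along a flat morphism of rings -/

section Restriction

variable {A B : Type u} [CommRing A] [Ring B] (f : A →+* B)

/-- The ring `B` as a right module over `A`, together with its left action on itself. -/
def RightMod (_ : A →+* B) : Type u := B

namespace RightMod

instance : AddCommGroup (RightMod f) := inferInstanceAs (AddCommGroup B)

instance : Module B (RightMod f) := inferInstanceAs (Module B B)

instance : Module A (RightMod f) where
  smul a x := (show B from x) * f a
  one_smul x := by
    change (show B from x) * f 1 = x
    rw [map_one, mul_one]
  mul_smul a a' x := by
    change (show B from x) * f (a * a') = (show B from x) * f a' * f a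
    rw [mul_comm, map_mul, mul_assoc]
  smul_zero a := zero_mul (f a)
  smul_add a x y := add_mul (show B from x) (show B from y) (f a)
  add_smul a a' x := by
    change (show B from x) * f (a + a') = (show B from x) * f a + (show B from x) * f a'
    rw [map_add, mul_add]
  zero_smul x := by
    change (show B from x) * f 0 = 0
    rw [map_zero, mul_zero]

theorem smul_def (a : A) (x : RightMod f) : a • x = ((show B from x) * f a : B) := rfl

instance : SMulCommClass A B (RightMod f) where
  smul_comm a x y := mul_assoc x (show B from y) (f a)

end RightMod

section

variable {N N' : Type u} [AddCommGroup N] [Module A N] [AddCommGroup N'] [Module A N']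
  {M : Type u} [AddCommGroup M] [Module B M]

/-- `B ⊗_A -` on linear maps, as a `B`-linear map. -/
def baseChangeMap (g : N →ₗ[A] N') : RightMod f ⊗[A] N →ₗ[B] RightMod f ⊗[A] N' :=
  { g.lTensor (RightMod f) with
    map_smul' := fun x t => by
      change g.lTensor (RightMod f) (x • t) = x • g.lTensor (RightMod f) t
      induction t using TensorProduct.induction_on with
      | zero => simp
      | add t t' h h' => simp only [smul_add, map_add, h, h']
      | tmul y n => simp [TensorProduct.smul_tmul'] }

variable {f} in
/-- The `B`-linear map `B ⊗_A N → M` adjoint to a map `N → M` which is linear along `f`. -/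
def baseChangeLift (g : N →+ M) (hg : ∀ (a : A) n, g (a • n) = f a • g n) :
    RightMod f ⊗[A] N →ₗ[B] M :=
  let h : RightMod f ⊗[A] N →+ M :=
    TensorProduct.liftAddHom
      { toFun := fun y => (DistribSMul.toAddMonoidHom M (show B from y)).comp g
        map_zero' := by ext n; exact zero_smul B (g n)
        map_add' := fun y y' => by
          ext n
          exact add_smul (show B from y) (show B from y') (g n) }
      (fun a y n => by
        change ((show B from y) * f a) • g n = (show B from y) • g (a • n)
        rw [hg, mul_smul])
  { h with
    map_smul' := fun x t => by
      change h (x • t) = x • h t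
      induction t using TensorProduct.induction_on with
      | zero => simp
      | add t t' h h' => simp only [smul_add, map_add, h, h']
      | tmul y n => exact mul_smul x (show B from y) (g n) }

end

/-- Flatness makes `B ⊗_A -` preserve monomorphisms, and its right adjoint, restriction of scalars,
then preserves injectives. The extension is found after base change and evaluated at `1 ⊗ y`. -/
theorem injective_restrictScalars (hf : Module.Flat A (RightMod f)) (M : ModuleCat.{u} B)
    [Injective M] : Injective ((ModuleCat.restrictScalars f).obj M) where
  factors {X Y} g i hi := by
    let g' : X →+ (ModuleCat.restrictScalars f).obj M := g.hom.toAddMonoidHom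
    let G : RightMod f ⊗[A] X →ₗ[B] M := baseChangeLift (M := M)
      (show X →+ M from g') (fun a n => g.hom.map_smul a n)
    let E := ModuleCat.ofHom (baseChangeMap f i.hom)
    have hE : Mono E := by
      rw [ModuleCat.mono_iff_injective] at hi ⊢
      exact Module.Flat.lTensor_preserves_injective_linearMap (M := RightMod f) i.hom hi
    let H := (Injective.factorThru (ModuleCat.ofHom G) E).hom
    have hH (t) : H (baseChangeMap f i.hom t) = G t :=
      congrArg (fun h => h.hom t) (Injective.comp_factorThru (ModuleCat.ofHom G) E)
    have hs (a : A) (y : Y) : H ((show RightMod f from (1 : B)) ⊗ₜ (a • y)) =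
        f a • H ((show RightMod f from (1 : B)) ⊗ₜ y) := by
      rw [← map_smul, TensorProduct.tmul_smul, TensorProduct.smul_tmul',
        TensorProduct.smul_tmul' (f a), RightMod.smul_def]
      congr 2
      change (1 : B) * f a = f a * 1
      rw [one_mul, mul_one]
    let h : Y →ₗ[A] (ModuleCat.restrictScalars f).obj M :=
      { toFun := fun y => H ((show RightMod f from (1 : B)) ⊗ₜ y)
        map_add' := fun y y' => by rw [TensorProduct.tmul_add, map_add]; rfl
        map_smul' := hs }
    refine ⟨ConcreteCategory.ofHom (C := ModuleCat.{u} A) h, ModuleCat.hom_ext (LinearMap.ext fun x => ?_)⟩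
    exact (hH ((show RightMod f from (1 : B)) ⊗ₜ x)).trans (one_smul B (show M from g' x))

end Restriction

/-! ### Projectivity of `U^e` as a right `S^e`-module. -/

section EnvelopingFlat

variable {k S : Type u} [Field k] [CommRing S] [Algebra k S]

theorem tmul_smul_finsuppTensorFinsupp {κ κ' : Type u} (s t : S) (v : κ →₀ S) (w : κ' →₀ S) :
    (s ⊗ₜ[k] t : Se k S) • finsuppTensorFinsupp k k S S κ κ' (v ⊗ₜ w) =
      finsuppTensorFinsupp k k S S κ κ' ((s • v) ⊗ₜ (t • w)) := by
  ext ⟨a, a'⟩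
  simp [finsuppTensorFinsupp_apply]

variable (k S) (L : Type u) [LieRing L] [LieAlgebra k L]
  [Module S L] [LieRingModule L S] [LieRinehartRing S L] [LieRinehartAlgebra k S L]

theorem tmul_mul_seToUe_tmul (u : Env k S L) (v : (Env k S L)ᵐᵒᵖ) (s t : S) :
    u ⊗ₜ[k] v * seToUe k S L (s ⊗ₜ[k] t) =
      (u * Env.i k S L s) ⊗ₜ[k] MulOpposite.op (Env.i k S L t * v.unop) := by
  simp [seToUe]

/-- Right multiplication by `s ⊗ t` acts on `U ⊗ U^op` by `i(s)` on the right of the first factor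
and, because of the opposite, by `i(t)` on the left of the second. The tensor product of a right and
a left retract is therefore a retract of a free `S^e`-module. -/
theorem projective_rightMod_seToUe [Module.Projective S L] :
    Module.Projective (Se k S) (RightMod (seToUe k S L).toRingHom) := by
  obtain ⟨κ, p, q, hqp, hp, hq⟩ := exists_right_retract k S L
  obtain ⟨κ', p', q', hqp', hp', hq'⟩ := exists_left_retract k S L
  let e := finsuppTensorFinsupp k k S S κ κ'
  let o := MulOpposite.opLinearEquiv k (M := Env k S L)
  let i₀ : Ue k S L →ₗ[k] (κ × κ' →₀ Se k S) :=
    e.toLinearMap ∘ₗ TensorProduct.map p (p' ∘ₗ o.symm.toLinearMap)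
  let r₀ : (κ × κ' →₀ Se k S) →ₗ[k] Ue k S L :=
    TensorProduct.map q (o.toLinearMap ∘ₗ q') ∘ₗ e.symm.toLinearMap
  have hi (a : Se k S) (x : Ue k S L) : i₀ (x * seToUe k S L a) = a • i₀ x := by
    induction x using TensorProduct.induction_on with
    | zero => simp
    | add x x' h h' => simp only [add_mul, map_add, h, h', smul_add]
    | tmul u v =>
      induction a using TensorProduct.induction_on with
      | zero => simp
      | add a a' h h' => simp only [mul_add, map_add, h, h', add_smul]
      | tmul s t =>
        rw [tmul_mul_seToUe_tmul]
        change e (p (u * Env.i k S L s) ⊗ₜ p' (Env.i k S L t * v.unop)) =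
          (s ⊗ₜ[k] t : Se k S) • e (p u ⊗ₜ p' v.unop)
        rw [hp, hp', tmul_smul_finsuppTensorFinsupp]
  have hr (a : Se k S) (w : κ × κ' →₀ Se k S) : r₀ (a • w) = r₀ w * seToUe k S L a := by
    obtain ⟨w, rfl⟩ := e.surjective w
    induction w using TensorProduct.induction_on with
    | zero => simp
    | add x x' h h' => simp only [add_mul, map_add, h, h', smul_add]
    | tmul v w =>
      induction a using TensorProduct.induction_on with
      | zero => simp
      | add a a' h h' => simp only [mul_add, map_add, h, h', add_smul]
      | tmul s t =>
        have h1 (x) : r₀ (e x) = TensorProduct.map q (o.toLinearMap ∘ₗ q') x := by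
          simp [r₀]
        rw [tmul_smul_finsuppTensorFinsupp, h1, h1, TensorProduct.map_tmul,
          TensorProduct.map_tmul, hq, LinearMap.comp_apply, hq', tmul_mul_seToUe_tmul]
        rfl
  let i : RightMod (seToUe k S L).toRingHom →ₗ[Se k S] (κ × κ' →₀ Se k S) :=
    { toFun := i₀, map_add' := map_add i₀, map_smul' := hi }
  let r : (κ × κ' →₀ Se k S) →ₗ[Se k S] RightMod (seToUe k S L).toRingHom :=
    { toFun := r₀, map_add' := map_add r₀, map_smul' := hr }
  refine Module.Projective.of_split i r (LinearMap.ext fun x => ?_)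
  change r₀ (i₀ x) = x
  have h2 : r₀ ∘ₗ i₀ = LinearMap.id := by
    ext u v
    simp [r₀, i₀, hqp, hqp', o]
  exact LinearMap.congr_fun h2 x

theorem injective_res [Module.Projective S L] (M : ModuleCat.{u} (Ue k S L)) [Injective M] :
    Injective ((res k S L).obj M) :=
  have := projective_rightMod_seToUe k S L
  injective_restrictScalars _ inferInstance M

end EnvelopingFlat

/-! ### Existence of liftings of operators over a derivation -/

section Lifting

variable {k : Type u} [Field k] {A : Type u} [CommRing A] [Algebra k A] (δ : Derivation k A A)

/-- On a free module `δ` acts on coefficients; compressing this operator to a direct summand keeps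
the Leibniz rule. -/
theorem exists_isDeltaOperator (X : Type u) [AddCommGroup X] [Module A X]
    [Module.Projective A X] : ∃ D : X →+ X, IsDeltaOperator δ D := by
  obtain ⟨σ, hσ⟩ := Module.projective_def'.mp (inferInstance : Module.Projective A X)
  let π := Finsupp.linearCombination A (id : X → X)
  let D₀ : (X →₀ A) →+ (X →₀ A) := Finsupp.mapRange.addMonoidHom (δ : A →ₗ[k] A).toAddMonoidHom
  have hD₀ (a : A) (v : X →₀ A) : D₀ (a • v) = δ a • v + a • D₀ v := by
    ext x
    simp [D₀, mul_comm, add_comm]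
  refine ⟨(π.toAddMonoidHom.comp D₀).comp σ.toAddMonoidHom, fun a x => ?_⟩
  have h : π (σ x) = x := LinearMap.congr_fun hσ x
  change π (D₀ (σ (a • x))) = δ a • x + a • π (D₀ (σ x))
  rw [map_smul, hD₀, map_add, map_smul, map_smul, h]

variable {δ}

/-- For any `δ`-operator `D` on `X`, the defect `g d - d D` is linear, since the terms in `δ`
cancel, and takes values in the range of `d`. Lifting it through `d` gives a linear correction to
`D`. -/
theorem exists_isDeltaOperator_comm {X Y : Type u} [AddCommGroup X] [Module A X]
    [Module.Projective A X] [AddCommGroup Y] [Module A Y] (d : X →ₗ[A] Y) {g : Y →+ Y}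
    (hg : IsDeltaOperator δ g) (h : ∀ x, ∃ x', d x' = g (d x)) :
    ∃ D : X →+ X, IsDeltaOperator δ D ∧ ∀ x, d (D x) = g (d x) := by
  obtain ⟨D, hD⟩ := exists_isDeltaOperator δ X
  let e : X →ₗ[A] LinearMap.range d :=
    { toFun := fun x => ⟨g (d x) - d (D x), by
        obtain ⟨x', hx'⟩ := h x
        exact ⟨x' - D x, by rw [map_sub, hx']⟩⟩
      map_add' := fun x y => Subtype.ext (by
        simp only [map_add, Submodule.coe_add]
        abel)
      map_smul' := fun a x => Subtype.ext (by
        simp only [map_smul, hg a, hD a, map_add, RingHom.id_apply, Submodule.coe_smul, smul_sub]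
        abel) }
  obtain ⟨t, ht⟩ := Module.projective_lifting_property d.rangeRestrict e d.surjective_rangeRestrict
  have ht' (x : X) : d (t x) = g (d x) - d (D x) :=
    congrArg Subtype.val (LinearMap.congr_fun ht x)
  refine ⟨D + t.toAddMonoidHom, fun a x => ?_, fun x => ?_⟩
  · change D (a • x) + t (a • x) = δ a • x + a • (D x + t x)
    rw [hD a, map_smul, smul_add, add_assoc]
  · change d (D x + t x) = _
    rw [map_add, ht', add_sub_cancel]

theorem nonempty_deltaLifting {V : ModuleCat.{u} A} {f : V →+ V} (hf : IsDeltaOperator δ f)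
    (P : ProjectiveResolution V) : Nonempty (DeltaLifting δ f P) := by
  have hproj (q : ℕ) : Module.Projective A (P.complex.X q) :=
    (IsProjective.iff_projective (P.complex.X q)).mpr (P.projective q)
  let d (q : ℕ) := (P.complex.d (q + 1) q).hom
  let π : P.complex.X 0 →ₗ[A] V := (show P.complex.X 0 ⟶ V from P.π.f 0).hom
  have hπ : Function.Surjective π := by
    have h : Epi (show P.complex.X 0 ⟶ V from P.π.f 0) := inferInstanceAs (Epi (P.π.f 0))
    exact (ModuleCat.epi_iff_surjective _).mp h
  have hπd (x) : π (d 0 x) = 0 := congrArg (fun g => g.hom x) P.complex_d_comp_π_f_zero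
  have hdd (q : ℕ) (x) : d q (d (q + 1) x) = 0 :=
    congrArg (fun g => g.hom x) (P.complex.d_comp_d (q + 2) (q + 1) q)
  have exact_zero (x) (hx : π x = 0) : ∃ y, d 0 y = x :=
    (ShortComplex.moduleCat_exact_iff _).mp P.exact₀ x hx
  have exact_succ (q : ℕ) (x) (hx : d q x = 0) : ∃ y, d (q + 1) y = x :=
    (ShortComplex.moduleCat_exact_iff _).mp (P.exact_succ q) x hx
  -- The recursion carries along that the operator preserves the image of the incoming differential,
  -- which is what the next lift needs and what exactness supplies.
  let T (q : ℕ) := {g : P.complex.X q →+ P.complex.X q //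
    IsDeltaOperator δ g ∧ ∀ x, ∃ x', d q x' = g (d q x)}
  obtain ⟨D, hD, hDπ⟩ := exists_isDeltaOperator_comm π hf fun x => hπ _
  let D₀ : T 0 := ⟨D, hD, fun x => exact_zero _ (by rw [hDπ, hπd, map_zero])⟩
  have step (q : ℕ) (g : T q) : ∃ g' : T (q + 1), ∀ x, d q (g'.1 x) = g.1 (d q x) := by
    obtain ⟨g', hg', h⟩ := exists_isDeltaOperator_comm (d q) g.2.1 g.2.2
    exact ⟨⟨g', hg', fun x => exact_succ q _ (by rw [h, hdd, map_zero])⟩, h⟩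
  choose F hF using step
  let D (q : ℕ) : T q := Nat.rec D₀ F q
  exact ⟨⟨fun q => (D q).1, fun q => (D q).2.1, fun q x => hF q (D q) x, hDπ⟩⟩

end Lifting

open CochainComplex HomComplex

/-! ### Comparing classes given by a projective and by an injective resolution -/

section Comparison

variable {C : Type*} [Category* C] [Abelian C] [HasExt.{u} C] {X Y : C}
  (P : ProjectiveResolution X) (R : InjectiveResolution Y)

/-- Out of a K-projective complex, morphisms up to homotopy and morphisms in the derived category
coincide. -/
theorem cohomologyClass_mk_eq_iff {K K' : CochainComplex C ℤ} {n : ℤ} [K.IsKProjective]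
    [HasDerivedCategory C] (x y : Cocycle K K' n) :
    CohomologyClass.mk x = CohomologyClass.mk y ↔
      ShiftedHom.map (Cocycle.equivHomShift.symm x) DerivedCategory.Q =
        ShiftedHom.map (Cocycle.equivHomShift.symm y) DerivedCategory.Q := by
  have hQ (f g : K ⟶ (K'⟦n⟧)) : DerivedCategory.Q.map f = DerivedCategory.Q.map g ↔
      DerivedCategory.Qh.map ((HomotopyCategory.quotient C _).map f) =
        DerivedCategory.Qh.map ((HomotopyCategory.quotient C _).map g) := by
    have e (f : K ⟶ (K'⟦n⟧)) := NatIso.naturality_1 (DerivedCategory.quotientCompQhIso C) f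
    rw [← e f, ← e g, cancel_epi, cancel_mono]
    rfl
  rw [ShiftedHom.map, ShiftedHom.map, cancel_mono, hQ,
    (IsKProjective.Qh_map_bijective _ _).injective.eq_iff, ← CohomologyClass.toHom_mk,
    ← CohomologyClass.toHom_mk, (CohomologyClass.toHom_bijective K K' n).injective.eq_iff]

theorem map_equivHomShift_symm_precomp {K K' K'' : CochainComplex C ℤ} {n : ℤ}
    [HasDerivedCategory C] (z : Cocycle K K' n) (g : K'' ⟶ K) :
    ShiftedHom.map (Cocycle.equivHomShift.symm (z.precomp g)) DerivedCategory.Q =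
      DerivedCategory.Q.map g ≫ ShiftedHom.map (Cocycle.equivHomShift.symm z) DerivedCategory.Q := by
  rw [Cocycle.equivHomShift_symm_precomp, ShiftedHom.map, ShiftedHom.map, Functor.map_comp,
    Category.assoc]

theorem map_equivHomShift_symm_postcomp {K K' K'' : CochainComplex C ℤ} {n : ℤ}
    [HasDerivedCategory C] (z : Cocycle K K' n) (g : K' ⟶ K'') :
    ShiftedHom.map (Cocycle.equivHomShift.symm (z.postcomp g)) DerivedCategory.Q =
      ShiftedHom.map (Cocycle.equivHomShift.symm z) DerivedCategory.Q ≫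
        (DerivedCategory.Q.map g)⟦n⟧' := by
  rw [Cocycle.equivHomShift_symm_postcomp, ShiftedHom.map, ShiftedHom.map, Functor.map_comp,
    Category.assoc, Category.assoc, ← Functor.commShiftIso_hom_naturality]

/-- The cocycle `P → R` given by a cocycle `φ : P_n → Y`. -/
def projCocycle {n : ℕ} (φ : P.complex.X n ⟶ Y) (hφ : P.complex.d (n + 1) n ≫ φ = 0) :
    Cocycle P.cochainComplex R.cochainComplex n :=
  Cocycle.postcomp (f := R.ι') (Cocycle.toSingleMk ((P.cochainComplexXIso (-n) n rfl).hom ≫ φ)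
    (neg_add_cancel (n : ℤ)) (-(n + 1 : ℕ)) (by lia) (by
      rw [P.cochainComplex_d _ _ _ _ rfl rfl]
      simp [hφ]))

/-- The cocycle `P → R` given by a cocycle `ψ : X → R^n`. -/
def injCocycle {n : ℕ} (ψ : X ⟶ R.cocomplex.X n) (hψ : ψ ≫ R.cocomplex.d n (n + 1) = 0) :
    Cocycle P.cochainComplex R.cochainComplex n :=
  (Cocycle.fromSingleMk (ψ ≫ (R.cochainComplexXIso n n rfl).inv)
    (zero_add (n : ℤ)) (n + 1 : ℕ) (by lia) (by
      rw [R.cochainComplex_d _ _ _ _ rfl rfl]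
      simp [reassoc_of% hψ])).precomp P.π'

/-- In the derived category `P → X` and `Y → R` are invertible, so both classes can be compared as
morphisms from `P` to a shift of `R`. As `P` is K-projective, equality there means being
cohomologous in the Hom complex. -/
theorem extMk_eq_extMk_iff {n : ℕ} (φ : P.complex.X n ⟶ Y)
    (hφ : P.complex.d (n + 1) n ≫ φ = 0) (ψ : X ⟶ R.cocomplex.X n)
    (hψ : ψ ≫ R.cocomplex.d n (n + 1) = 0) :
    P.extMk φ (n + 1) rfl hφ = R.extMk ψ (n + 1) rfl hψ ↔
      ∃ z : Cochain P.cochainComplex R.cochainComplex (n - 1),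
        δ (n - 1) n z = (projCocycle P R φ hφ).1 - (injCocycle P R ψ hψ).1 := by
  have := HasDerivedCategory.standard C
  trans CohomologyClass.mk (projCocycle P R φ hφ) = CohomologyClass.mk (injCocycle P R ψ hψ)
  · rw [cohomologyClass_mk_eq_iff, Abelian.Ext.ext_iff, P.extMk_hom, R.extMk_hom, projCocycle,
      injCocycle, map_equivHomShift_symm_precomp, map_equivHomShift_symm_postcomp]
    simp only [ShiftedHom.mk₀_comp, ShiftedHom.comp_mk₀, Category.assoc, Functor.map_comp,
      cancel_epi, Functor.map_inv]
    rw [← Category.assoc, ← Category.assoc (ShiftedHom.map _ _), cancel_mono,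
      IsIso.inv_comp_eq, ← Category.assoc, IsIso.eq_comp_inv]
  · rw [← sub_eq_zero, ← CohomologyClass.mk_sub, CohomologyClass.mk_eq_zero_iff,
      mem_coboundaries_iff _ (n - 1 : ℤ) (by lia)]
    rfl

end Comparison

/-! ### Operators over a derivation on cochain complexes -/

section CochainOperators

variable {k : Type u} [Field k] {A : Type u} [CommRing A] [Algebra k A] {D : Derivation k A A}

variable (D) in
/-- A family of operators over the derivation `D` on the terms of a complex, commuting with the
differentials. -/
structure DeltaOps (K : CochainComplex (ModuleCat.{u} A) ℤ) where
  /-- the operators -/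
  op : ∀ p : ℤ, K.X p →+ K.X p
  isDeltaOperator : ∀ p, IsDeltaOperator D (op p)
  comm : ∀ (p q : ℤ) (x : K.X p), (K.d p q).hom (op p x) = op q ((K.d p q).hom x)

/-- The transport of an operator along an isomorphism. -/
def conjOp {V W : ModuleCat.{u} A} (e : V ≅ W) (g : W →+ W) : V →+ V :=
  (e.inv.hom.toAddMonoidHom.comp g).comp e.hom.hom.toAddMonoidHom

section Conj

variable {V W : ModuleCat.{u} A} (e : V ≅ W) {g : W →+ W}

theorem hom_conjOp (x : V) : e.hom.hom (conjOp e g x) = g (e.hom.hom x) :=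
  congrArg (fun h => h.hom (g (e.hom.hom x))) e.inv_hom_id

theorem inv_apply_op (y : W) : conjOp e g (e.inv.hom y) = e.inv.hom (g y) := by
  have h : e.hom.hom (e.inv.hom y) = y := congrArg (fun h => h.hom y) e.inv_hom_id
  change e.inv.hom (g (e.hom.hom (e.inv.hom y))) = _
  rw [h]

theorem conjOp_isDeltaOperator (hg : IsDeltaOperator D g) : IsDeltaOperator D (conjOp e g) := by
  intro a x
  have h : e.inv.hom (e.hom.hom x) = x := congrArg (fun h => h.hom x) e.hom_inv_id
  change e.inv.hom (g (e.hom.hom (a • x))) = D a • x + a • e.inv.hom (g (e.hom.hom x))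
  rw [map_smul, hg, map_add, map_smul, map_smul, h]

end Conj

/-- The operator `φ ↦ b φ - φ a` on cochains. -/
def DeltaOps.sharp {K K' : CochainComplex (ModuleCat.{u} A) ℤ} (a : DeltaOps D K)
    (b : DeltaOps D K') {n : ℤ} (z : Cochain K K' n) : Cochain K K' n :=
  Cochain.mk fun p q hpq =>
    ModuleCat.ofHom (LieRinehart.sharp (a.isDeltaOperator p) (b.isDeltaOperator q) (z.v p q hpq).hom)

section Sharp

variable {K K' : CochainComplex (ModuleCat.{u} A) ℤ} (a : DeltaOps D K) (b : DeltaOps D K') {n : ℤ}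

theorem DeltaOps.sharp_v_apply (z : Cochain K K' n) (p q : ℤ) (hpq : p + n = q) (x : K.X p) :
    ((a.sharp b z).v p q hpq).hom x =
      b.op q ((z.v p q hpq).hom x) - (z.v p q hpq).hom (a.op p x) := by
  rw [DeltaOps.sharp, Cochain.mk_v]
  rfl

theorem DeltaOps.sharp_sub (z z' : Cochain K K' n) :
    a.sharp b (z - z') = a.sharp b z - a.sharp b z' := by
  ext p q hpq x
  simp only [DeltaOps.sharp_v_apply, Cochain.sub_v, ModuleCat.hom_sub, LinearMap.sub_apply, map_sub]
  abel

/-- The differential of a cochain is built from composition with the two differentials, and the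
operators commute with both. -/
theorem DeltaOps.δ_sharp (m : ℤ) (hnm : n + 1 = m) (z : Cochain K K' n) :
    δ n m (a.sharp b z) = a.sharp b (δ n m z) := by
  ext p q hpq x
  have h (w : Cochain K K' n) (x : K.X p) : ((δ n m w).v p q hpq).hom x =
      (K'.d (q - 1) q).hom ((w.v p (q - 1) (by lia)).hom x) +
        (m.negOnePow : ℤ) • (w.v (p + 1) q (by lia)).hom ((K.d p (p + 1)).hom x) := by
    rw [δ_v n m hnm w p q hpq (q - 1) (p + 1) rfl rfl]
    rfl
  rw [DeltaOps.sharp_v_apply, h, h, h, DeltaOps.sharp_v_apply, DeltaOps.sharp_v_apply, map_sub,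
    b.comm, a.comm, map_add, map_zsmul, smul_sub]
  abel

end Sharp

section Extension

variable {V : ModuleCat.{u} A} (P : ProjectiveResolution V)
  (g : ∀ q : ℕ, P.complex.X q →+ P.complex.X q)

/-- The extension by zero of operators on a projective resolution. -/
def projOp (p : ℤ) : P.cochainComplex.X p →+ P.cochainComplex.X p :=
  if h : -((-p).toNat : ℤ) = p then conjOp (P.cochainComplexXIso p (-p).toNat h) (g _) else 0

theorem projOp_eq (p : ℤ) (n : ℕ) (h : -(n : ℤ) = p) :
    projOp P g p = conjOp (P.cochainComplexXIso p n h) (g n) := by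
  obtain rfl : n = (-p).toNat := by lia
  rw [projOp, dif_pos h]

theorem subsingleton_cochainComplex_X_of_pos (p : ℤ) (h : 0 < p) :
    Subsingleton (P.cochainComplex.X p) :=
  ModuleCat.subsingleton_of_isZero (isZero_of_isStrictlyLE _ 0 p h)

/-- The extension by zero of operators on a projective resolution which commute with the
differentials. -/
def projOps (hg : ∀ q, IsDeltaOperator D (g q))
    (comm : ∀ (q : ℕ) (x : P.complex.X (q + 1)),
      (P.complex.d (q + 1) q).hom (g (q + 1) x) = g q ((P.complex.d (q + 1) q).hom x)) :
    DeltaOps D P.cochainComplex where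
  op := projOp P g
  isDeltaOperator p := by
    rcases le_or_gt p 0 with h | h
    · rw [projOp_eq P g p (-p).toNat (by lia)]
      exact conjOp_isDeltaOperator _ (hg _)
    · have := subsingleton_cochainComplex_X_of_pos P p h
      exact fun _ _ => Subsingleton.elim _ _
  comm p q x := by
    by_cases hpq : p + 1 = q
    · rcases le_or_gt q 0 with h | h
      · obtain ⟨n, rfl⟩ : ∃ n : ℕ, q = -(n : ℤ) := ⟨(-q).toNat, by lia⟩
        obtain rfl : p = -((n + 1 : ℕ) : ℤ) := by lia
        rw [projOp_eq P g _ n rfl, projOp_eq P g _ (n + 1) rfl,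
          P.cochainComplex_d _ _ (n + 1) n rfl rfl]
        simp only [ModuleCat.hom_comp, LinearMap.comp_apply, hom_conjOp, comm, inv_apply_op]
      · have := subsingleton_cochainComplex_X_of_pos P q h
        exact Subsingleton.elim _ _
    · rw [P.cochainComplex.shape p q hpq]
      simp

end Extension

section InjExtension

variable {V : ModuleCat.{u} A} (R : InjectiveResolution V)
  (g : ∀ q : ℕ, R.cocomplex.X q →+ R.cocomplex.X q)

/-- The extension by zero of operators on an injective resolution. -/
def injOp (p : ℤ) : R.cochainComplex.X p →+ R.cochainComplex.X p :=
  if h : (p.toNat : ℤ) = p then conjOp (R.cochainComplexXIso p p.toNat h) (g _) else 0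

theorem injOp_eq (p : ℤ) (n : ℕ) (h : (n : ℤ) = p) :
    injOp R g p = conjOp (R.cochainComplexXIso p n h) (g n) := by
  obtain rfl : n = p.toNat := by lia
  rw [injOp, dif_pos h]

theorem subsingleton_cochainComplex_X_of_neg (p : ℤ) (h : p < 0) :
    Subsingleton (R.cochainComplex.X p) :=
  ModuleCat.subsingleton_of_isZero (isZero_of_isStrictlyGE _ 0 p h)

/-- The extension by zero of operators on an injective resolution which commute with the
differentials. -/
def injOps (hg : ∀ q, IsDeltaOperator D (g q))
    (comm : ∀ (q : ℕ) (x : R.cocomplex.X q),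
      (R.cocomplex.d q (q + 1)).hom (g q x) = g (q + 1) ((R.cocomplex.d q (q + 1)).hom x)) :
    DeltaOps D R.cochainComplex where
  op := injOp R g
  isDeltaOperator p := by
    rcases le_or_gt 0 p with h | h
    · rw [injOp_eq R g p p.toNat (by lia)]
      exact conjOp_isDeltaOperator _ (hg _)
    · have := subsingleton_cochainComplex_X_of_neg R p h
      exact fun _ _ => Subsingleton.elim _ _
  comm p q x := by
    by_cases hpq : p + 1 = q
    · rcases le_or_gt 0 p with h | h
      · obtain ⟨n, rfl⟩ : ∃ n : ℕ, p = (n : ℤ) := ⟨p.toNat, by lia⟩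
        obtain rfl : q = ((n + 1 : ℕ) : ℤ) := by lia
        rw [injOp_eq R g _ n rfl, injOp_eq R g _ (n + 1) rfl,
          R.cochainComplex_d _ _ n (n + 1) rfl rfl]
        simp only [ModuleCat.hom_comp, LinearMap.comp_apply, hom_conjOp, comm, inv_apply_op]
      · have := subsingleton_cochainComplex_X_of_neg R p h
        rw [Subsingleton.elim x 0]
        simp
    · rw [R.cochainComplex.shape p q hpq]
      simp

end InjExtension

end CochainOperators

/-! ### Operators on `Ext` given by operators on resolutions -/

section BiCochain

variable {C : Type*} [Category* C] [Abelian C] {X Y : C}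
  (P : ProjectiveResolution X) (R : InjectiveResolution Y)

/-- The augmentation `P_0 → X`. -/
abbrev aug : P.complex.X 0 ⟶ X := P.π.f 0

/-- The coaugmentation `Y → R^0`. -/
abbrev coaug : Y ⟶ R.cocomplex.X 0 := R.ι.f 0

/-- The cochain given by a morphism `P_i → R^j`. -/
def biCochain {i j : ℕ} (h : P.complex.X i ⟶ R.cocomplex.X j) (n : ℤ) :
    Cochain P.cochainComplex R.cochainComplex n :=
  Cochain.single ((P.cochainComplexXIso (-i) i rfl).hom ≫ h ≫ (R.cochainComplexXIso j j rfl).inv) n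

theorem comp_inv_comp_hom {X₁ X₂ X₃ X₄ X₅ : C} (a : X₁ ⟶ X₂) (b : X₂ ⟶ X₃) (e : X₄ ≅ X₃)
    (c : X₃ ⟶ X₅) : (a ≫ b ≫ e.inv) ≫ e.hom ≫ c = a ≫ b ≫ c := by
  simp

/-- Writing both kinds of cocycle as cochains with a single component lets the operator be computed
on them by one formula. -/
theorem projCocycle_coe {n : ℕ} (φ : P.complex.X n ⟶ Y) (hφ : P.complex.d (n + 1) n ≫ φ = 0) :
    (projCocycle P R φ hφ).1 = biCochain P R (φ ≫ coaug R) n := by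
  ext p q hpq
  by_cases hp : p = -n
  · obtain rfl : q = ((0 : ℕ) : ℤ) := by lia
    subst hp
    rw [biCochain, Cochain.single_v]
    change ((Cochain.toSingleMk _ (neg_add_cancel (n : ℤ))).comp (Cochain.ofHom R.ι')
      (add_zero (n : ℤ))).v _ _ _ = _
    rw [Cochain.comp_zero_cochain_v, Cochain.ofHom_v]
    erw [Cochain.toSingleMk_v, R.ι'_f_zero]
    simp only [Category.assoc]
    exact comp_inv_comp_hom _ _ _ _
  · rw [biCochain, Cochain.single_v_eq_zero _ _ _ _ _ hp]
    change ((Cochain.toSingleMk _ (neg_add_cancel (n : ℤ))).comp (Cochain.ofHom R.ι')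
      (add_zero (n : ℤ))).v _ _ _ = _
    rw [Cochain.comp_zero_cochain_v, Cochain.toSingleMk_v_eq_zero _ _ _ _ _ hp, Limits.zero_comp]

theorem injCocycle_coe {n : ℕ} (ψ : X ⟶ R.cocomplex.X n)
    (hψ : ψ ≫ R.cocomplex.d n (n + 1) = 0) :
    (injCocycle P R ψ hψ).1 = biCochain P R (aug P ≫ ψ) n := by
  ext p q hpq
  by_cases hp : p = -((0 : ℕ) : ℤ)
  · obtain rfl : q = (n : ℤ) := by lia
    subst hp
    rw [biCochain, Cochain.single_v]
    change ((Cochain.ofHom P.π').comp (Cochain.fromSingleMk _ (zero_add (n : ℤ)))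
      (zero_add (n : ℤ))).v _ _ _ = _
    rw [Cochain.zero_cochain_comp_v, Cochain.ofHom_v]
    erw [Cochain.fromSingleMk_v, P.π'_f_zero]
    simp only [Category.assoc]
    exact comp_inv_comp_hom _ _ _ _
  · rw [biCochain, Cochain.single_v_eq_zero _ _ _ _ _ hp]
    change ((Cochain.ofHom P.π').comp (Cochain.fromSingleMk _ (zero_add (n : ℤ)))
      (zero_add (n : ℤ))).v _ _ _ = _
    rw [Cochain.zero_cochain_comp_v, Cochain.fromSingleMk_v_eq_zero _ _ _ _ _ (by simpa using hp),
      Limits.comp_zero]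

end BiCochain

/-! ### Operators preserve equality of classes across the two resolutions. -/

section ExtOperators

variable {k : Type u} [Field k] {A : Type u} [CommRing A] [Algebra k A] {D : Derivation k A A}
  {V W : ModuleCat.{u} A} {P : ProjectiveResolution V} {R : InjectiveResolution W}

theorem sharp_biCochain {f : ∀ q : ℕ, P.complex.X q →+ P.complex.X q}
    {g : ∀ q : ℕ, R.cocomplex.X q →+ R.cocomplex.X q}
    (hf : ∀ q, IsDeltaOperator D (f q)) (hg : ∀ q, IsDeltaOperator D (g q))
    (hfd : ∀ (q : ℕ) (x : P.complex.X (q + 1)),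
      (P.complex.d (q + 1) q).hom (f (q + 1) x) = f q ((P.complex.d (q + 1) q).hom x))
    (hgd : ∀ (q : ℕ) (x : R.cocomplex.X q),
      (R.cocomplex.d q (q + 1)).hom (g q x) = g (q + 1) ((R.cocomplex.d q (q + 1)).hom x))
    {i j : ℕ} (h : P.complex.X i ⟶ R.cocomplex.X j) (n : ℤ) (hij : -(i : ℤ) + n = j) :
    (projOps P f hf hfd).sharp (injOps R g hg hgd) (biCochain P R h n) =
      biCochain P R (ModuleCat.ofHom (sharp (hf i) (hg j) h.hom)) n := by
  ext p q hpq x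
  rw [DeltaOps.sharp_v_apply]
  by_cases hp : p = -i
  · obtain rfl : q = (j : ℤ) := by lia
    subst hp
    rw [biCochain, Cochain.single_v, biCochain, Cochain.single_v]
    change injOp R g j _ - ((P.cochainComplexXIso (-i) i rfl).hom ≫ h ≫
      (R.cochainComplexXIso j j rfl).inv).hom (projOp P f (-i) x) = _
    rw [injOp_eq R g j j rfl, projOp_eq P f (-i) i rfl]
    simp only [ModuleCat.hom_comp, LinearMap.comp_apply, inv_apply_op, hom_conjOp,
      ModuleCat.hom_ofHom, sharp_apply, map_sub]
  · rw [biCochain, Cochain.single_v_eq_zero _ _ _ _ _ hp, biCochain,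
      Cochain.single_v_eq_zero _ _ _ _ _ hp]
    simp

/-- If `z` bounds the difference of the two cocycles, its image under the operator bounds the
difference of their images. Compatibility with the augmentations identifies these with the cocycles
of the transformed `φ` and `ψ`. -/
theorem extMk_sharp_eq_extMk_sharp {f : ∀ q : ℕ, P.complex.X q →+ P.complex.X q}
    {g : ∀ q : ℕ, R.cocomplex.X q →+ R.cocomplex.X q} {fV : V →+ V} {gW : W →+ W}
    (hfV : IsDeltaOperator D fV) (hgW : IsDeltaOperator D gW)
    (hf : ∀ q, IsDeltaOperator D (f q)) (hg : ∀ q, IsDeltaOperator D (g q))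
    (hfd : ∀ (q : ℕ) (x : P.complex.X (q + 1)),
      (P.complex.d (q + 1) q).hom (f (q + 1) x) = f q ((P.complex.d (q + 1) q).hom x))
    (hgd : ∀ (q : ℕ) (x : R.cocomplex.X q),
      (R.cocomplex.d q (q + 1)).hom (g q x) = g (q + 1) ((R.cocomplex.d q (q + 1)).hom x))
    (hfε : ∀ x, (aug P).hom (f 0 x) = fV ((aug P).hom x))
    (hgη : ∀ y, (coaug R).hom (gW y) = g 0 ((coaug R).hom y))
    {n : ℕ} (φ : P.complex.X n ⟶ W) (hφ : P.complex.d (n + 1) n ≫ φ = 0)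
    (hφ' : P.complex.d (n + 1) n ≫ ModuleCat.ofHom (sharp (hf n) hgW φ.hom) = 0)
    (ψ : V ⟶ R.cocomplex.X n) (hψ : ψ ≫ R.cocomplex.d n (n + 1) = 0)
    (hψ' : ModuleCat.ofHom (sharp hfV (hg n) ψ.hom) ≫ R.cocomplex.d n (n + 1) = 0)
    (h : P.extMk φ (n + 1) rfl hφ = R.extMk ψ (n + 1) rfl hψ) :
    P.extMk (ModuleCat.ofHom (sharp (hf n) hgW φ.hom)) (n + 1) rfl hφ' =
      R.extMk (ModuleCat.ofHom (sharp hfV (hg n) ψ.hom)) (n + 1) rfl hψ' := by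
  rw [extMk_eq_extMk_iff] at h ⊢
  obtain ⟨z, hz⟩ := h
  refine ⟨(projOps P f hf hfd).sharp (injOps R g hg hgd) z, ?_⟩
  rw [DeltaOps.δ_sharp _ _ _ (by lia), hz, DeltaOps.sharp_sub, projCocycle_coe, projCocycle_coe,
    injCocycle_coe, injCocycle_coe, sharp_biCochain hf hg hfd hgd _ _ (by lia),
    sharp_biCochain hf hg hfd hgd _ _ (by lia)]
  congr 2
  · ext x
    simp [sharp_apply, hgη]
  · ext x
    simp [sharp_apply, hfε]

end ExtOperators

/-! ### The module structures on `H^n(S, M)` -/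

/-- The module structure on a quotient of a `U`-module by a stable subspace. -/
theorem exists_algHom_of_surjective {k U Z H : Type*} [Field k] [Ring U] [Algebra k U]
    [AddCommGroup Z] [Module U Z] [AddCommGroup H] [Module k H] (c : Z →+ H)
    (hc : Function.Surjective c) (hk : ∀ (r : k) (z : Z), c (algebraMap k U r • z) = r • c z)
    (hker : ∀ (u : U) (z : Z), c z = 0 → c (u • z) = 0) :
    ∃ ρ : U →ₐ[k] Module.End k H, ∀ u z, ρ u (c z) = c (u • z) := by
  have hwd (u : U) (z z' : Z) (h : c z = c z') : c (u • z) = c (u • z') := by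
    rw [← sub_eq_zero, ← map_sub, ← smul_sub]
    exact hker u _ (by rw [map_sub, h, sub_self])
  -- An arbitrary set-theoretic section suffices, because `c (u • z)` depends only on `u` and `c z`.
  let s := Function.surjInv hc
  have hs (u : U) (z : Z) : c (u • s (c z)) = c (u • z) :=
    hwd u _ _ (Function.surjInv_eq hc _)
  let f (u : U) : Module.End k H :=
    { toFun := fun h => c (u • s h)
      map_add' := fun x y => by
        obtain ⟨x, rfl⟩ := hc x
        obtain ⟨y, rfl⟩ := hc y
        rw [← map_add, hs, hs, hs, smul_add, map_add]
      map_smul' := fun r x => by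
        obtain ⟨x, rfl⟩ := hc x
        rw [← hk, hs, hs, RingHom.id_apply, ← mul_smul, ← Algebra.commutes, mul_smul, hk] }
  have hf (u : U) (z : Z) : f u (c z) = c (u • z) := hs u z
  have hext (g g' : Module.End k H) (h : ∀ z, g (c z) = g' (c z)) : g = g' :=
    LinearMap.ext fun x => by
      obtain ⟨z, rfl⟩ := hc x
      exact h z
  refine ⟨{ toFun := f, map_one' := ?_, map_mul' := ?_, map_zero' := ?_, map_add' := ?_,
            commutes' := ?_ }, hf⟩
  · exact hext _ _ fun z => by rw [hf, one_smul, Module.End.one_apply]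
  · exact fun u v => hext _ _ fun z => by rw [hf, Module.End.mul_apply, hf, hf, mul_smul]
  · exact hext _ _ fun z => by rw [hf, zero_smul, map_zero, LinearMap.zero_apply]
  · exact fun u v => hext _ _ fun z => by rw [LinearMap.add_apply, hf, hf, hf, add_smul, map_add]
  · exact fun r => hext _ _ fun z => by
      rw [hf, hk, Module.algebraMap_end_apply]

section LinearExt

variable {A : Type*} [CommRing A] {C : Type*} [Category* C] [Abelian C] [Linear A C]
  [HasExt.{u} C] {X Y : C}

theorem smul_projExtMk (P : ProjectiveResolution X) (a : A) {n : ℕ} (φ : P.complex.X n ⟶ Y)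
    (hφ : P.complex.d (n + 1) n ≫ φ = 0) :
    a • P.extMk φ (n + 1) rfl hφ = P.extMk (a • φ) (n + 1) rfl (by simp [hφ]) := by
  rw [Abelian.Ext.smul_eq_comp_mk₀, P.extMk_comp_mk₀]
  congr 1
  simp

theorem smul_injExtMk (R : InjectiveResolution Y) (a : A) {n : ℕ} (ψ : X ⟶ R.cocomplex.X n)
    (hψ : ψ ≫ R.cocomplex.d n (n + 1) = 0) :
    a • R.extMk ψ (n + 1) rfl hψ = R.extMk (a • ψ) (n + 1) rfl (by simp [hψ]) := by
  rw [← (R.extMk ψ (n + 1) rfl hψ).mk₀_id_comp, ← Abelian.Ext.smul_comp, ← Abelian.Ext.mk₀_smul,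
    R.mk₀_comp_extMk]
  congr 1
  simp

end LinearExt

/-! ### Classes of cocycles, and existence, uniqueness and comparison of the induced actions. -/

section Structures

variable {k S L : Type u} [Field k] [CommRing S] [Algebra k S] [LieRing L] [LieAlgebra k L]
  [Module S L] [LieRingModule L S] [LieRinehartRing S L] [LieRinehartAlgebra k S L]
  {M : ModuleCat.{u} (Ue k S L)}

theorem commOp_map {M N : ModuleCat.{u} (Ue k S L)} (f : M ⟶ N) (α : L) (m : (res k S L).obj M) :
    ((res k S L).map f).hom (commOp M α m) = commOp N α (((res k S L).map f).hom m) := by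
  have h (m : M) : f.hom ((Env.j k S L α ⊗ₜ[k] (1 : (Env k S L)ᵐᵒᵖ) : Ue k S L) • m
      - ((1 : Env k S L) ⊗ₜ[k] MulOpposite.op (Env.j k S L α) : Ue k S L) • m) =
      (Env.j k S L α ⊗ₜ[k] (1 : (Env k S L)ᵐᵒᵖ) : Ue k S L) • f.hom m
      - ((1 : Env k S L) ⊗ₜ[k] MulOpposite.op (Env.j k S L α) : Ue k S L) • f.hom m := by
    simp
  exact h m

variable (I : InjectiveResolution M) (hI : ∀ q, Injective ((res k S L).obj (I.cocomplex.X q)))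
  (P : ProjectiveResolution (bimod k S)) (n : ℕ)

theorem coaug_restrictResolution :
    coaug (restrictResolution I hI) = (res k S L).map (coaug I) := by
  change ((HomologicalComplex.singleMapHomologicalComplex (res k S L) (ComplexShape.up ℕ) 0).inv.app
    M).f 0 ≫
    (res k S L).map (I.ι.f 0) = _
  rw [HomologicalComplex.singleMapHomologicalComplex_inv_app_self]
  exact Category.id_comp _

theorem injClass_surjective (x : HH M n) : ∃ ψ hψ, injClass I hI n ψ hψ = x := by
  obtain ⟨f, hf, rfl⟩ := (restrictResolution I hI).extMk_surjective x (n + 1) rfl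
  exact ⟨f.hom, congrArg ModuleCat.Hom.hom hf, rfl⟩

theorem projClass_surjective (x : HH M n) : ∃ φ hφ, projClass P n φ hφ = x := by
  obtain ⟨f, hf, rfl⟩ := P.extMk_surjective x (n + 1) rfl
  exact ⟨f.hom, congrArg ModuleCat.Hom.hom hf, rfl⟩

theorem injClass_add (ψ ψ' : (G k S L).obj (I.cocomplex.X n))
    (hψ : ((G k S L).map (I.cocomplex.d n (n + 1))).hom ψ = 0)
    (hψ' : ((G k S L).map (I.cocomplex.d n (n + 1))).hom ψ' = 0) :
    injClass I hI n (ψ + ψ') (by rw [map_add, hψ, hψ', add_zero]) =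
      injClass I hI n ψ hψ + injClass I hI n ψ' hψ' :=
  ((restrictResolution I hI).add_extMk _ _ _ _ _ _).symm

theorem injClass_zero : injClass I hI n 0 (map_zero _) = 0 :=
  (restrictResolution I hI).extMk_zero _ _

/-- `i(s)` acts on cocycles as the scalar `s ⊗ 1` of `S^e`, and `Ext` is linear over `S^e`. -/
theorem injClass_i_smul (s : S) (ψ : (G k S L).obj (I.cocomplex.X n))
    (hψ : ((G k S L).map (I.cocomplex.d n (n + 1))).hom ψ = 0) :
    injClass I hI n (Env.i k S L s • ψ) (by rw [map_smul, hψ, smul_zero]) =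
      (s ⊗ₜ[k] (1 : S) : Se k S) • injClass I hI n ψ hψ := by
  refine Eq.trans ?_ (smul_injExtMk (restrictResolution I hI) _ _ _).symm
  have h : GHom.toHom (Env.i k S L s • (show GHom (I.cocomplex.X n) from ψ)) =
      (s ⊗ₜ[k] (1 : S) : Se k S) • GHom.toHom (M := I.cocomplex.X n) ψ := by
    rw [GHom.i_smul]
    rfl
  rw [injClass]
  congr 1

theorem projClass_homS (s : S) (φ : P.complex.X n →ₗ[Se k S] (res k S L).obj M)
    (hφ : φ ∘ₗ (P.complex.d (n + 1) n).hom = 0)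
    (hφ' : homS k S (P.complex.X n) ((res k S L).obj M) s φ ∘ₗ (P.complex.d (n + 1) n).hom = 0) :
    projClass P n (homS k S (P.complex.X n) ((res k S L).obj M) s φ) hφ' =
      (s ⊗ₜ[k] (1 : S) : Se k S) • projClass P n φ hφ := by
  rw [projClass, projClass, smul_projExtMk]
  congr 1

theorem algebraMap_smul_HH (r : k) (x : HH M n) :
    (algebraMap k S r ⊗ₜ[k] (1 : S) : Se k S) • x = r • x := by
  rw [Abelian.Ext.smul_eq_comp_mk₀, Abelian.Ext.smul_eq_comp_mk₀]
  congr 2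

variable {I hI P n} in
-- The operators on `I` are `α ⊗ 1 - 1 ⊗ α`, which commute with all `U^e`-linear maps, in particular
-- the differentials and the coaugmentation. The right side does not involve the lifting, hence
-- neither does the class on the left.
theorem projClass_alphaSharp_eq {α : L} (a : AnchorLifting α P)
    {φ : P.complex.X n →ₗ[Se k S] (res k S L).obj M} {hφ : φ ∘ₗ (P.complex.d (n + 1) n).hom = 0}
    {ψ : (G k S L).obj (I.cocomplex.X n)}
    {hψ : ((G k S L).map (I.cocomplex.d n (n + 1))).hom ψ = 0}
    (h : projClass P n φ hφ = injClass I hI n ψ hψ) :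
    projClass P n (alphaSharp a n φ) (alphaSharp_comp_d a n φ hφ) =
      injClass I hI n (Env.j k S L α • ψ) (by rw [map_smul, hψ, smul_zero]) := by
  have e : (Env.j k S L α • ψ : (G k S L).obj (I.cocomplex.X n)) =
      sharp (anchorOp_isDeltaOperator α) (commOp_isDeltaOperator (I.cocomplex.X n) α)
        (show GHom (I.cocomplex.X n) from ψ) := GHom.j_smul (M := I.cocomplex.X n) α ψ
  have e' : ((G k S L).map (I.cocomplex.d n (n + 1))).hom (Env.j k S L α • ψ) = 0 := by
    rw [map_smul, hψ, smul_zero]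
  have := extMk_sharp_eq_extMk_sharp (R := restrictResolution I hI)
    (g := fun q => commOp (I.cocomplex.X q) α)
    (anchorOp_isDeltaOperator α) (commOp_isDeltaOperator M α)
    a.isDeltaOperator (fun q => commOp_isDeltaOperator (I.cocomplex.X q) α) a.comm
    (fun q x => commOp_map (I.cocomplex.d q (q + 1)) α x) a.comm_augmentation
    (fun y => by
      rw [coaug_restrictResolution]
      exact commOp_map (coaug I) α y)
    (ConcreteCategory.ofHom (C := ModuleCat.{u} (Se k S)) φ) (ModuleCat.hom_ext hφ)
    (ModuleCat.hom_ext (alphaSharp_comp_d a n φ hφ))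
    (GHom.toHom ψ) (ModuleCat.hom_ext hψ)
    (ModuleCat.hom_ext (by rw [e] at e'; exact e')) h
  simp only [e]
  exact this

theorem injClass_smul_eq_zero (hP : ∀ α : L, Nonempty (AnchorLifting α P)) (u : Env k S L)
    (ψ : (G k S L).obj (I.cocomplex.X n))
    (hψ : ((G k S L).map (I.cocomplex.d n (n + 1))).hom ψ = 0) (h : injClass I hI n ψ hψ = 0) :
    injClass I hI n (u • ψ) (by rw [map_smul, hψ, smul_zero]) = 0 := by
  induction u using Env.induction generalizing ψ with
  | hi s => rw [injClass_i_smul _ _ _ _ _ hψ, h, smul_zero]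
  | hj α =>
    obtain ⟨a⟩ := hP α
    -- The zero class is also represented by `φ = 0` on the projective side, and `α^♯ 0 = 0`.
    have h0 : projClass (M := M) P n 0 (LinearMap.zero_comp _) = 0 := P.extMk_zero _ _
    rw [← projClass_alphaSharp_eq a (h0.trans h.symm)]
    refine Eq.trans ?_ h0
    congr 1
    ext x
    simp [alphaSharp, sharp_apply]
  | hadd u v hu hv =>
    simp only [add_smul]
    rw [injClass_add _ _ _ _ _ (by rw [map_smul, hψ, smul_zero]) (by rw [map_smul, hψ, smul_zero]),
      hu ψ hψ h, hv ψ hψ h, add_zero]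
  | hmul u v hu hv =>
    simp only [mul_smul]
    exact hu _ _ (hv ψ hψ h)

theorem exists_isInducedByInjective (hP : ∀ α : L, Nonempty (AnchorLifting α P)) :
    ∃ ρ : Env k S L →ₐ[k] Module.End k (HH M n), IsInducedByInjective I hI n ρ := by
  let Z := LinearMap.ker ((G k S L).map (I.cocomplex.d n (n + 1))).hom
  let c : Z →+ HH M n :=
    { toFun := fun z => injClass I hI n z.1 z.2
      map_zero' := injClass_zero I hI n
      map_add' := fun z z' => injClass_add I hI n _ _ z.2 z'.2 }
  obtain ⟨ρ, hρ⟩ := exists_algHom_of_surjective (k := k) (U := Env k S L) c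
    (fun x => by
      obtain ⟨ψ, hψ, rfl⟩ := injClass_surjective I hI n x
      exact ⟨⟨ψ, hψ⟩, rfl⟩)
    (fun r z => by
      rw [← AlgHom.commutes (Env.i k S L), ← algebraMap_smul_HH]
      exact injClass_i_smul I hI n _ _ z.2)
    (fun u z hz => injClass_smul_eq_zero I hI P n hP u z.1 z.2 hz)
  exact ⟨ρ, fun u ψ hψ => hρ u ⟨ψ, hψ⟩⟩

variable {I hI P n}

theorem IsInducedByInjective.eq {ρ ρ' : Env k S L →ₐ[k] Module.End k (HH M n)}
    (h : IsInducedByInjective I hI n ρ) (h' : IsInducedByInjective I hI n ρ') : ρ = ρ' := by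
  ext u x
  obtain ⟨ψ, hψ, rfl⟩ := injClass_surjective I hI n x
  rw [h u ψ hψ, h' u ψ hψ]

theorem IsInducedByProjectiveS.eq {ρ ρ' : S →ₐ[k] Module.End k (HH M n)}
    (h : IsInducedByProjectiveS P n ρ) (h' : IsInducedByProjectiveS P n ρ') : ρ = ρ' := by
  ext s x
  obtain ⟨φ, hφ, rfl⟩ := projClass_surjective P n x
  rw [h s φ hφ, h' s φ hφ]

theorem IsInducedByProjectiveL.eq (hP : ∀ α : L, Nonempty (AnchorLifting α P))
    {ρ ρ' : L →ₗ⁅k⁆ Module.End k (HH M n)}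
    (h : IsInducedByProjectiveL P n ρ) (h' : IsInducedByProjectiveL P n ρ') : ρ = ρ' := by
  ext α x
  obtain ⟨a⟩ := hP α
  obtain ⟨φ, hφ, rfl⟩ := projClass_surjective P n x
  rw [h α a φ hφ, h' α a φ hφ]

theorem IsInducedByInjective.isInducedByProjectiveS {ρ : Env k S L →ₐ[k] Module.End k (HH M n)}
    (h : IsInducedByInjective I hI n ρ) : IsInducedByProjectiveS P n (ρ.comp (Env.i k S L)) := by
  intro s φ hφ
  obtain ⟨ψ, hψ, e⟩ := injClass_surjective I hI n (projClass P n φ hφ)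
  rw [projClass_homS P n s φ hφ, ← e, AlgHom.comp_apply, h _ ψ hψ, injClass_i_smul _ _ _ _ _ hψ]

/-- Representing the class of `φ` by some `ψ` on the injective side reduces this to
`projClass_alphaSharp_eq`. The Lie module axioms for the projective structure are thus inherited
from `U`. -/
theorem IsInducedByInjective.isInducedByProjectiveL {ρ : Env k S L →ₐ[k] Module.End k (HH M n)}
    (h : IsInducedByInjective I hI n ρ) :
    IsInducedByProjectiveL P n ((ρ : Env k S L →ₗ⁅k⁆ Module.End k (HH M n)).comp (Env.j k S L)) := by
  intro α a φ hφ
  obtain ⟨ψ, hψ, e⟩ := injClass_surjective I hI n (projClass P n φ hφ)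
  rw [projClass_alphaSharp_eq a e.symm, ← e]
  exact h _ ψ hψ

end Structures

end LieRinehart

end

theorem mainTheorem5 {k S L : Type u} [Field k] [CommRing S] [Algebra k S] [LieRing L]
    [LieAlgebra k L] [Module S L] [LieRingModule L S] [LieRinehartRing S L]
    [LieRinehartAlgebra k S L] (hL : Module.Projective S L)
    (M : ModuleCat.{u} (LieRinehart.Ue k S L))
    (I : InjectiveResolution M) (P : ProjectiveResolution (LieRinehart.bimod k S)) :
    (∀ α : L, Nonempty (LieRinehart.AnchorLifting α P)) ∧
    ∃ hI : ∀ q, Injective ((LieRinehart.res k S L).obj (I.cocomplex.X q)),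
    ∀ n : ℕ,
      (∃! ρ : LieRinehart.Env k S L →ₐ[k] Module.End k (LieRinehart.HH M n),
        LieRinehart.IsInducedByInjective I hI n ρ) ∧
      (∃! ρS : S →ₐ[k] Module.End k (LieRinehart.HH M n),
        LieRinehart.IsInducedByProjectiveS P n ρS) ∧
      (∃! ρL : L →ₗ⁅k⁆ Module.End k (LieRinehart.HH M n),
        LieRinehart.IsInducedByProjectiveL P n ρL) ∧
      ∀ (ρ : LieRinehart.Env k S L →ₐ[k] Module.End k (LieRinehart.HH M n))
        (ρS : S →ₐ[k] Module.End k (LieRinehart.HH M n))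
        (ρL : L →ₗ⁅k⁆ Module.End k (LieRinehart.HH M n)),
        LieRinehart.IsInducedByInjective I hI n ρ →
        LieRinehart.IsInducedByProjectiveS P n ρS →
        LieRinehart.IsInducedByProjectiveL P n ρL →
        (∀ s : S, ρ (LieRinehart.Env.i k S L s) = ρS s) ∧
        (∀ α : L, ρ (LieRinehart.Env.j k S L α) = ρL α) := by
  have hP (α : L) : Nonempty (LieRinehart.AnchorLifting α P) :=
    LieRinehart.nonempty_deltaLifting (LieRinehart.anchorOp_isDeltaOperator α) P
  have hI (q : ℕ) : Injective ((LieRinehart.res k S L).obj (I.cocomplex.X q)) :=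
    have := I.injective q
    LieRinehart.injective_res k S L (I.cocomplex.X q)
  refine ⟨hP, hI, fun n => ?_⟩
  obtain ⟨ρ, hρ⟩ := LieRinehart.exists_isInducedByInjective I hI P n hP
  refine ⟨⟨ρ, hρ, fun _ h => h.eq hρ⟩,
    ⟨_, hρ.isInducedByProjectiveS, fun _ h => h.eq hρ.isInducedByProjectiveS⟩,
    ⟨_, hρ.isInducedByProjectiveL, fun _ h => h.eq hP hρ.isInducedByProjectiveL⟩, ?_⟩
  intro ρ' ρS ρL h hS hL
  -- The restrictions of the `U`-structure along `i` and `j` satisfy the projective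
  -- characterisations, so uniqueness identifies them with the given structures.
  exact ⟨fun s => DFunLike.congr_fun (h.isInducedByProjectiveS.eq hS) s,
    fun α => LieHom.congr_fun (h.isInducedByProjectiveL.eq hP hL) α⟩
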